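/- Let $\mathbb{L}\subset\mathbb{R}^3$ be a lattice spanned by a basis of $\mathbb{R}^3$, with unit cell $\Gamma$. For $n\ge 1$ let $L^2_n$ be the space of real $n\mathbb{L}$-periodic, locally square integrable functions with norm $\|f\|_{L^2_n}=\bigl(n^{-3}\int_{n\Gamma}|f|^2\,dx\bigr)^{1/2}$, and let $H^k_n$ be the space of those $f\in L^2_n$ all of whose weak derivatives $\partial^\alpha f$, $|\alpha|\le k$, lie in $L^2_n$, with norm $\|f\|_{H^k_n}=\sum_{|\alpha|\le k}\|\partial^\alpha f\|_{L^2_n}$. The cubes $(L^2_n)^3$, $(H^k_n)^3$ carry the norm $\|u\|=\bigl(\sum_{i}\|u_i\|^2\bigr)^{1/2}$. Let $\rho_b$ be a real $C^\infty$, $\mathbb{L}$-periodic function. For $h\in\mathbb{R}$, a triple $u=(\nu_+,\nu_-,V)\in(H^3_1)^3$ with $\nu_\pm\ge 0$ is said to solve the unit-cell Euler–Lagrange equations with constant magnetic field $h$, written $\mathcal{F}(u,h)=0$, if \begin{align*} &-\Delta\nu_+ +\tfrac53\nu_+^{7/3}-\tfrac43\nu_+^{5/3}+(V-h)\nu_+=0,\\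 &-\Delta\nu_- +\tfrac53\nu_-^{7/3}-\tfrac43\nu_-^{5/3}+(V+h)\nu_-=0,\\ &-\Delta V=4\pi(\nu_+^2+\nu_-^2-\rho_b) \end{align*} almost everywhere in $\Gamma$. Let $u_{\mathrm{per}}=(\nu_{+,\mathrm{per}},\nu_{-,\mathrm{per}},V_{\mathrm{per}})\in(H^3_1)^3$ satisfy $\mathcal{F}(u_{\mathrm{per}},0)=0$ and $\nu_{\pm,\mathrm{per}}\ge C_\nu$ almost everywhere, for some constant $C_\nu>0$. Assume stability: there is a constant $M$, independent of $n$, such that for every $n\ge 1$ the operator $$\mathcal{L}_{\mathrm{per}}=\begin{pmatrix}\mathcal{L}_{+}&0&\nu_{+,\mathrm{per}}\\0&\mathcal{L}_{-}&\nu_{-,\mathrm{per}}\\ \nu_{+,\mathrm{per}}&\nu_{-,\mathrm{per}}&\tfrac1{8\pi}\Delta\end{pmatrix},\qquad \mathcal{L}_{\pm}\omega=-\Delta\omega+\tfrac{35}{9}\nu_{\pm,\mathrm{per}}^{4/3}\omega-\tfrac{20}{9}\nu_{\pm,\mathrm{per}}^{2/3}\omega+V_{\mathrm{per}}\,\omega,$$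 on $(L^2_n)^3$ with domain $(H^2_n)^3$ has a bounded inverse on $(L^2_n)^3$ with $\|\mathcal{L}_{\mathrm{per}}^{-1}\|_{\mathscr{L}((L^2_n)^3)}\le M$. Then there exist positive constants $h_0$ and $\delta$ and a unique $C^\infty$ map $h\mapsto u(\cdot;h)$ from $[-h_0,h_0]$ to $(H^3_1)^3$ such that, for every $h\in[-h_0,h_0]$, $$\|u(\cdot;h)-u_{\mathrm{per}}\|_{(H^3_1)^3}\le\delta\qquad\text{and}\qquad\mathcal{F}(u(\cdot;h),h)=0 .$$ -/

import Mathlib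

open scoped Pointwise ContDiff ENNReal
open MeasureTheory

noncomputable section

namespace TFDW

/-- The physical space `ℝ³` with its Euclidean structure. -/
abbrev E3 : Type := EuclideanSpace ℝ (Fin 3)

/-- `f` is `n𝕃`-periodic, where `𝕃` is the Bravais lattice spanned over `ℤ` by the basis `b`. -/
def IsPeriodic (b : Module.Basis (Fin 3) ℝ E3) (n : ℕ) (f : E3 → ℝ) : Prop :=
  ∀ R ∈ Submodule.span ℤ (Set.range b), ∀ x : E3, f (x + (n : ℝ) • R) = f x

/-- The (super)cell `nΓ`, where the unit cell `Γ` is the half-open parallelepiped spanned by `b`. -/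
def cell (b : Module.Basis (Fin 3) ℝ E3) (n : ℕ) : Set E3 :=
  (n : ℝ) • ZSpan.fundamentalDomain b

/-- The measure `n⁻³ dx` on the cell `nΓ`. -/
def cellMeasure (b : Module.Basis (Fin 3) ℝ E3) (n : ℕ) : Measure E3 :=
  ((n : ℝ≥0∞) ^ 3)⁻¹ • (volume : Measure E3).restrict (cell b n)

/-- The space `L²ₙ` of `n𝕃`-periodic locally square integrable functions, with norm
`(n⁻³ ∫_{nΓ} |f|²)^(1/2)`. A periodic function is represented by its restriction to `nΓ`. -/
abbrev PeriodicL2 (b : Module.Basis (Fin 3) ℝ E3) (n : ℕ) : Type :=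
  Lp ℝ 2 (cellMeasure b n)

/-- The classical partial derivative `∂ᵢ φ`. -/
def partialDeriv (i : Fin 3) (φ : E3 → ℝ) : E3 → ℝ :=
  fun x => fderiv ℝ φ x (EuclideanSpace.single i 1)

/-- The classical partial derivative `∂^α φ` of a smooth function, `α` a multi-index. -/
def multiDeriv (α : Fin 3 → ℕ) (φ : E3 → ℝ) : E3 → ℝ :=
  (partialDeriv 0)^[α 0] ((partialDeriv 1)^[α 1] ((partialDeriv 2)^[α 2] φ))

/-- The multi-indices `α` with `|α| ≤ k`. -/
def multiIndices (k : ℕ) : Finset (Fin 3 → ℕ) :=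
  (Fintype.piFinset fun _ => Finset.range (k + 1)).filter fun α => ∑ i, α i ≤ k

/-- `g` is the weak derivative `∂^α f` of the `n𝕃`-periodic function `f`
(tested against smooth `n𝕃`-periodic functions). -/
def HasWeakDeriv (b : Module.Basis (Fin 3) ℝ E3) (n : ℕ) (α : Fin 3 → ℕ)
    (f g : PeriodicL2 b n) : Prop :=
  ∀ φ : E3 → ℝ, ContDiff ℝ ∞ φ → IsPeriodic b n φ →
    ∫ x, f x * multiDeriv α φ x ∂(cellMeasure b n) =
      (-1) ^ (∑ i, α i) * ∫ x, g x * φ x ∂(cellMeasure b n)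

theorem mem_multiIndices {k : ℕ} {α : Fin 3 → ℕ} : α ∈ multiIndices k ↔ ∑ i, α i ≤ k := by
  simp only [multiIndices, Finset.mem_filter, Fintype.mem_piFinset, Finset.mem_range,
    and_iff_right_iff_imp]
  intro h i
  have := Finset.single_le_sum (f := α) (fun j _ => Nat.zero_le _) (Finset.mem_univ i)
  omega

theorem zero_mem_multiIndices (k : ℕ) : (0 : Fin 3 → ℕ) ∈ multiIndices k := by
  simp [mem_multiIndices]

theorem single_two_mem_multiIndices {k : ℕ} (hk : 2 ≤ k) (i : Fin 3) :
    (Pi.single i 2 : Fin 3 → ℕ) ∈ multiIndices k := by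
  simpa [mem_multiIndices] using hk

theorem contDiff_partialDeriv (i : Fin 3) {φ : E3 → ℝ} (hφ : ContDiff ℝ ∞ φ) :
    ContDiff ℝ ∞ (partialDeriv i φ) :=
  (hφ.fderiv_right (m := ∞) (by simp)).clm_apply contDiff_const

theorem contDiff_iterate_partialDeriv (i : Fin 3) (m : ℕ) {φ : E3 → ℝ} (hφ : ContDiff ℝ ∞ φ) :
    ContDiff ℝ ∞ ((partialDeriv i)^[m] φ) := by
  induction m with
  | zero => simpa using hφ
  | succ m ih =>
    rw [Function.iterate_succ_apply']
    exact contDiff_partialDeriv i ih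

theorem contDiff_multiDeriv (α : Fin 3 → ℕ) {φ : E3 → ℝ} (hφ : ContDiff ℝ ∞ φ) :
    ContDiff ℝ ∞ (multiDeriv α φ) :=
  contDiff_iterate_partialDeriv _ _
    (contDiff_iterate_partialDeriv _ _ (contDiff_iterate_partialDeriv _ _ hφ))

theorem isBounded_cell (b : Module.Basis (Fin 3) ℝ E3) (n : ℕ) : Bornology.IsBounded (cell b n) :=
  (ZSpan.fundamentalDomain_isBounded b).smul₀ _

theorem measurableSet_cell (b : Module.Basis (Fin 3) ℝ E3) (n : ℕ) : MeasurableSet (cell b n) :=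
  (ZSpan.fundamentalDomain_measurableSet b).const_smul₀ _

theorem ae_cell (b : Module.Basis (Fin 3) ℝ E3) (n : ℕ) :
    ∀ᵐ x ∂(cellMeasure b n), x ∈ cell b n :=
  Measure.ae_smul_measure (ae_restrict_mem (measurableSet_cell b n)) _

instance (b : Module.Basis (Fin 3) ℝ E3) (n : ℕ) : IsFiniteMeasure (cellMeasure b n) := by
  rcases Nat.eq_zero_or_pos n with rfl | hn
  · have h : volume (cell b 0) = 0 := by
      refine measure_mono_null (t := {0}) ?_ (by simp)
      rintro x ⟨y, -, rfl⟩
      simp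
    have h' : cellMeasure b 0 = 0 := by
      rw [cellMeasure, Measure.restrict_eq_zero.2 h, smul_zero]
    rw [h']
    infer_instance
  · refine ⟨?_⟩
    simp only [cellMeasure, Measure.smul_apply, smul_eq_mul, Measure.restrict_apply_univ]
    refine ENNReal.mul_lt_top ?_ (isBounded_cell b n).measure_lt_top
    have : (n : ℝ≥0∞) ≠ 0 := by simpa using hn.ne'
    simpa [ENNReal.inv_lt_top, pos_iff_ne_zero] using hn.ne'

theorem integrable_mul_of_continuous (b : Module.Basis (Fin 3) ℝ E3) (n : ℕ) (f : PeriodicL2 b n)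
    {ψ : E3 → ℝ} (hψ : Continuous ψ) : Integrable (fun x => f x * ψ x) (cellMeasure b n) := by
  obtain ⟨C, hC⟩ := ((isBounded_cell b n).isCompact_closure.exists_bound_of_continuousOn
    hψ.continuousOn)
  have hf : Integrable f (cellMeasure b n) := (Lp.memLp f).integrable (by norm_num)
  refine hf.mul_bdd (c := C) hψ.aestronglyMeasurable ?_
  filter_upwards [ae_cell b n] with x hx
  exact hC x (subset_closure hx)

/-- The periodic Sobolev space `Hᵏₙ`. A function `f ∈ Hᵏₙ` is recorded by the family
`(∂^α f)_{|α| ≤ k}` of its weak derivatives, which it determines, and the norm is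
`‖f‖ = ∑_{|α| ≤ k} ‖∂^α f‖_{L²ₙ}`. -/
def PeriodicSobolev (b : Module.Basis (Fin 3) ℝ E3) (n k : ℕ) :
    Submodule ℝ (PiLp 1 fun _ : multiIndices k => PeriodicL2 b n) where
  carrier := {F | ∀ α : multiIndices k,
    HasWeakDeriv b n α (F ⟨0, zero_mem_multiIndices k⟩) (F α)}
  zero_mem' := by
    intro α φ hφ hper
    have h : (fun x => (0 : PeriodicL2 b n) x) =ᵐ[cellMeasure b n] 0 := Lp.coeFn_zero _ _ _
    have h1 : ∀ ψ : E3 → ℝ, ∫ x, (0 : PeriodicL2 b n) x * ψ x ∂(cellMeasure b n) = 0 := by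
      intro ψ
      refine integral_eq_zero_of_ae ?_
      filter_upwards [h] with x hx
      simp only [hx, Pi.zero_apply, zero_mul]
    simp only [PiLp.zero_apply]
    rw [h1, h1, mul_zero]
  add_mem' := by
    intro F G hF hG α φ hφ hper
    have key : ∀ (f g : PeriodicL2 b n) (ψ : E3 → ℝ), Continuous ψ →
        ∫ x, (f + g) x * ψ x ∂(cellMeasure b n) =
          ∫ x, f x * ψ x ∂(cellMeasure b n) + ∫ x, g x * ψ x ∂(cellMeasure b n) := by
      intro f g ψ hψ
      rw [← integral_add (integrable_mul_of_continuous b n f hψ)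
        (integrable_mul_of_continuous b n g hψ)]
      refine integral_congr_ae ?_
      filter_upwards [Lp.coeFn_add f g] with x hx
      rw [hx, Pi.add_apply, add_mul]
    simp only [PiLp.add_apply]
    rw [key _ _ _ (contDiff_multiDeriv α hφ).continuous, key _ _ _ hφ.continuous,
      hF α φ hφ hper, hG α φ hφ hper, mul_add]
  smul_mem' := by
    intro c F hF α φ hφ hper
    have key : ∀ (f : PeriodicL2 b n) (ψ : E3 → ℝ),
        ∫ x, (c • f) x * ψ x ∂(cellMeasure b n) = c * ∫ x, f x * ψ x ∂(cellMeasure b n) := by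
      intro f ψ
      rw [← integral_const_mul]
      refine integral_congr_ae ?_
      filter_upwards [Lp.coeFn_smul c f] with x hx
      rw [hx, Pi.smul_apply, smul_eq_mul, mul_assoc]
    simp only [PiLp.smul_apply]
    rw [key, key, hF α φ hφ hper]
    ring

/-- The weak derivative `∂^α f ∈ L²ₙ` of `f ∈ Hᵏₙ`, for `|α| ≤ k`. -/
def PeriodicSobolev.weakDeriv {b : Module.Basis (Fin 3) ℝ E3} {n k : ℕ}
    (f : PeriodicSobolev b n k) (α : Fin 3 → ℕ) (hα : α ∈ multiIndices k) : PeriodicL2 b n :=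
  f.1 ⟨α, hα⟩

/-- The function underlying an element of `Hᵏₙ`. -/
def PeriodicSobolev.toL2 {b : Module.Basis (Fin 3) ℝ E3} {n k : ℕ}
    (f : PeriodicSobolev b n k) : PeriodicL2 b n :=
  PeriodicSobolev.weakDeriv f 0 (zero_mem_multiIndices k)

/-- The Laplacian `Δ f ∈ L²ₙ` of `f ∈ Hᵏₙ`, `k ≥ 2`. -/
def PeriodicSobolev.laplacian {b : Module.Basis (Fin 3) ℝ E3} {n k : ℕ} (hk : 2 ≤ k)
    (f : PeriodicSobolev b n k) : PeriodicL2 b n :=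
  ∑ i : Fin 3, PeriodicSobolev.weakDeriv f (Pi.single i 2) (single_two_mem_multiIndices hk i)

/-- The product space `X³` with the norm `(∑ᵢ ‖uᵢ‖²)^(1/2)`. A triple `(ν₊, ν₋, V)` has
entries `u 0 = ν₊`, `u 1 = ν₋`, `u 2 = V`. -/
abbrev Triple (X : Type) : Type := PiLp 2 fun _ : Fin 3 => X

/-- The `𝕃`-periodic extension to `ℝ³` of a function on the unit cell `Γ`. -/
def periodicExtension (b : Module.Basis (Fin 3) ℝ E3) (f : E3 → ℝ) : E3 → ℝ :=
  fun x => f (ZSpan.fract b x)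

/-- `u = (ν₊, ν₋, V) ∈ (H³₁)³`, with `ν₊, ν₋ ≥ 0`, solves the unit-cell Euler–Lagrange equations
`F(u, h) = 0` with charge background `ρb` and constant magnetic field `h`. -/
def SolvesEulerLagrange (b : Module.Basis (Fin 3) ℝ E3) (ρb : E3 → ℝ) (h : ℝ)
    (u : Triple (PeriodicSobolev b 1 3)) : Prop :=
  let νp := PeriodicSobolev.toL2 (u 0)
  let νm := PeriodicSobolev.toL2 (u 1)
  let V := PeriodicSobolev.toL2 (u 2)
  let Δνp := PeriodicSobolev.laplacian (by norm_num) (u 0)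
  let Δνm := PeriodicSobolev.laplacian (by norm_num) (u 1)
  let ΔV := PeriodicSobolev.laplacian (by norm_num) (u 2)
  ∀ᵐ x ∂(cellMeasure b 1),
    0 ≤ νp x ∧ 0 ≤ νm x ∧
    -Δνp x + 5 / 3 * νp x ^ (7 / 3 : ℝ) - 4 / 3 * νp x ^ (5 / 3 : ℝ) + (V x - h) * νp x = 0 ∧
    -Δνm x + 5 / 3 * νm x ^ (7 / 3 : ℝ) - 4 / 3 * νm x ^ (5 / 3 : ℝ) + (V x + h) * νm x = 0 ∧
    -ΔV x = 4 * Real.pi * (νp x ^ 2 + νm x ^ 2 - ρb x)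

/-- `L θ = f` on `nΓ`, where `L` is the linearized operator
with domain `(H²ₙ)³` and coefficients `ν₊, ν₋, V`. -/
def LinearizedEq (b : Module.Basis (Fin 3) ℝ E3) (n : ℕ) (νp νm V : E3 → ℝ)
    (θ : Triple (PeriodicSobolev b n 2)) (f : Triple (PeriodicL2 b n)) : Prop :=
  let θp := PeriodicSobolev.toL2 (θ 0)
  let θm := PeriodicSobolev.toL2 (θ 1)
  let W := PeriodicSobolev.toL2 (θ 2)
  let Δθp := PeriodicSobolev.laplacian le_rfl (θ 0)
  let Δθm := PeriodicSobolev.laplacian le_rfl (θ 1)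
  let ΔW := PeriodicSobolev.laplacian le_rfl (θ 2)
  ∀ᵐ x ∂(cellMeasure b n),
    -Δθp x + 35 / 9 * νp x ^ (4 / 3 : ℝ) * θp x - 20 / 9 * νp x ^ (2 / 3 : ℝ) * θp x
      + V x * θp x + νp x * W x = f 0 x ∧
    -Δθm x + 35 / 9 * νm x ^ (4 / 3 : ℝ) * θm x - 20 / 9 * νm x ^ (2 / 3 : ℝ) * θm x
      + V x * θm x + νm x * W x = f 1 x ∧
    νp x * θp x + νm x * θm x + 1 / (8 * Real.pi) * ΔW x = f 2 x

/-- Stability of the electronic structure `uPer`: with a constant `M` independent of `n`, for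
every `n ≥ 1` the operator `L_per` on `(L²ₙ)³` with domain `(H²ₙ)³` has a bounded inverse `T`
on `(L²ₙ)³` of norm at most `M`. -/
def IsStable (b : Module.Basis (Fin 3) ℝ E3) (uPer : Triple (PeriodicSobolev b 1 3)) : Prop :=
  ∃ M : ℝ, ∀ n : ℕ, 1 ≤ n →
    ∃ T : Triple (PeriodicL2 b n) →L[ℝ] Triple (PeriodicL2 b n), ‖T‖ ≤ M ∧
      ∀ f w : Triple (PeriodicL2 b n), T f = w ↔
        ∃ θ : Triple (PeriodicSobolev b n 2), (∀ i, PeriodicSobolev.toL2 (θ i) = w i) ∧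
          LinearizedEq b n (periodicExtension b (PeriodicSobolev.toL2 (uPer 0)))
            (periodicExtension b (PeriodicSobolev.toL2 (uPer 1)))
            (periodicExtension b (PeriodicSobolev.toL2 (uPer 2))) θ f

/-- `h ↦ u(·; h)` is a `C^∞` map from `[-h₀, h₀]` to `(H³₁)³` which stays within `δ` of `uPer`
and solves the Euler–Lagrange equations. -/
def IsCauchyBornMap (b : Module.Basis (Fin 3) ℝ E3) (ρb : E3 → ℝ)
    (uPer : Triple (PeriodicSobolev b 1 3)) (h₀ δ : ℝ)
    (u : ℝ → Triple (PeriodicSobolev b 1 3)) : Prop :=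
  ContDiffOn ℝ ∞ u (Set.Icc (-h₀) h₀) ∧
    ∀ h ∈ Set.Icc (-h₀) h₀, ‖u h - uPer‖ ≤ δ ∧ SolvesEulerLagrange b ρb h (u h)

end TFDW

end

/-!
The Euler–Lagrange equations become a fixed point equation `u = (1 - Δ)⁻¹ N(h, u)` in `(H³)³`: add
`u` to both sides and replace the function `5/3 t^{7/3} - 4/3 t^{5/3}` by a function `f` which is
smooth on the whole line, which changes nothing for densities bounded below. A solution branch
through `(0, u_per)` is then given by the implicit function theorem, applied to
`residual : (h, u) ↦ u - (1 - Δ)⁻¹ N(h, u)`.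

Smoothness of `residual`. In place of `H³` and its multiplication, the nonlinearity `N` (`reaction`)
acts on `GradPair`, pairs of a bounded continuous function and a family in `L²` which stands for its
gradient. There products (`pairMul`) and compositions with smooth functions (`pairComp`) are defined
by the product and chain rules and are smooth maps. `H²` embeds into this space (`gradPair`) because
`∑ₖ (1 + |ξₖ|²)⁻²` converges in dimension three. In the other direction `(1 - Δ)⁻¹` is written as
`(w, g) ↦ (1 - Δ)⁻² (w - div g)`, which is bounded from all of `GradPair` to `H³` and agrees with
`(1 - Δ)⁻¹ w` as soon as `g = ∇w` (`resolvent`, `toL2_eq_resolvent_iff`). The identity `g = ∇w`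
holds on the closure of the smooth functions (`gradClosure`), and `N` preserves this closed
subspace.

Weak derivatives. Fourier series on the cell, transported from the torus, give `∂^α f = g` weakly if
and only if the Fourier coefficients satisfy `ĝ(k) = (iξₖ)^α f̂(k)` (`hasWeakDeriv_iff`): the test
functions `cos(⟨k, x⟩ + θ)` give one direction, Parseval and integration by parts the other.
Completeness of the Sobolev spaces and the elliptic regularity that is needed follow from this.

Invertibility. The derivative of `residual` in `u` at `(0, u_per)` is
`w ↦ w - (1 - Δ)⁻¹ N'(u_per) w`, and `w - (1 - Δ)⁻¹ N'(u_per) w = g` is equivalent to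
`L_per w = (1 - Δ) g` up to a rescaling of the last equation. Stability on the unit cell provides a
unique solution in `H²`, and the equation itself puts it into `H³` (`isInvertible_fderiv_residual`).

Uniqueness of the branch is the uniqueness in the implicit function theorem: in a small ball around
`u_per` the sup-norm bound keeps the densities bounded below, so that the Euler–Lagrange equations
and `residual (h, u) = 0` have the same solutions there.
-/

noncomputable section

namespace TFDW

open scoped ComplexConjugate BoundedContinuousFunction Topology

/-! ### The unit cell and the torus -/

section

/-- The torus `(ℝ/ℤ)³`. -/
abbrev Torus3 : Type := UnitAddTorus (Fin 3)

/-- The Haar probability measure on the torus. -/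
def torusMeasure : Measure Torus3 := Measure.pi fun _ => AddCircle.haarAddCircle

instance : IsProbabilityMeasure torusMeasure := by
  unfold torusMeasure; infer_instance

/-- The map `∑ⱼ tⱼ bⱼ ↦ (tⱼ mod 1)ⱼ` from space to the torus. -/
def cellToTorus (b : Module.Basis (Fin 3) ℝ E3) (x : E3) : Torus3 :=
  fun j => ((b.repr x j : ℝ) : UnitAddCircle)

/-- The section of `cellToTorus` with values in the half-open unit cell. -/
def torusToCell (b : Module.Basis (Fin 3) ℝ E3) (t : Torus3) : E3 :=
  b.equivFun.symm fun j => (AddCircle.equivIco 1 0 (t j) : ℝ)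

variable (b : Module.Basis (Fin 3) ℝ E3)

theorem cellMeasure_one :
    cellMeasure b 1 = (volume : Measure E3).restrict (ZSpan.fundamentalDomain b) := by
  simp [cellMeasure, cell]

theorem ae_mem_fundamentalDomain :
    ∀ᵐ x ∂(cellMeasure b 1), x ∈ ZSpan.fundamentalDomain b := by
  simpa [cell] using ae_cell b 1

theorem measurable_cellToTorus : Measurable (cellToTorus b) := by
  refine measurable_pi_lambda _ fun j => AddCircle.measurable_mk'.comp ?_
  exact ((b.coord j).continuous_of_finiteDimensional).measurable

theorem measurable_torusToCell : Measurable (torusToCell b) := by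
  refine (b.equivFun.symm.toLinearMap.continuous_of_finiteDimensional).measurable.comp ?_
  refine measurable_pi_lambda _ fun j => ?_
  exact measurable_subtype_coe.comp
    ((AddCircle.measurableEquivIco 1 0).measurable.comp (measurable_pi_apply j))

theorem cellToTorus_torusToCell (t : Torus3) : cellToTorus b (torusToCell b t) = t := by
  funext j
  simp only [cellToTorus, torusToCell, ← Module.Basis.equivFun_apply, LinearEquiv.apply_symm_apply]
  exact (AddCircle.equivIco 1 0).symm_apply_apply (t j)

theorem torusToCell_cellToTorus {x : E3} (hx : x ∈ ZSpan.fundamentalDomain b) :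
    torusToCell b (cellToTorus b x) = x := by
  have h : ∀ j, ((AddCircle.equivIco 1 0 (cellToTorus b x j) : Set.Ico (0 : ℝ) (0 + 1)) : ℝ)
      = b.repr x j := by
    intro j
    have h2 := (AddCircle.equivIco (1 : ℝ) 0).apply_symm_apply
      ⟨b.repr x j, by simpa using hx j⟩
    exact congrArg Subtype.val h2
  simp only [torusToCell, h, ← Module.Basis.equivFun_apply]
  exact b.equivFun.symm_apply_apply x

/-- The ratio between the Lebesgue measure of the cell and the Haar measure of the torus exists and
is positive; its value is not needed. -/
theorem exists_measurePreserving_cellToTorus :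
    ∃ c : ℝ≥0∞, c ≠ 0 ∧ c ≠ ⊤ ∧
      MeasurePreserving (cellToTorus b) (cellMeasure b 1) (c • torusMeasure) := by
  let e : E3 ≃L[ℝ] (Fin 3 → ℝ) := b.equivFun.toContinuousLinearEquiv
  let c := ((volume : Measure E3).map e).addHaarScalarFactor volume
  have hc : (volume : Measure E3).map e = c • volume := Measure.isAddLeftInvariant_eq_smul _ _
  let s : Set (Fin 3 → ℝ) := Set.univ.pi fun _ => Set.Ico (0 : ℝ) 1
  have hs : MeasurableSet s := MeasurableSet.univ_pi fun _ => measurableSet_Ico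
  have he : MeasurePreserving e volume (c • (volume : Measure (Fin 3 → ℝ))) :=
    ⟨e.continuous.measurable, hc⟩
  have hpre : e ⁻¹' s = ZSpan.fundamentalDomain b := by
    ext x
    simp only [s, Set.mem_preimage, Set.mem_pi, Set.mem_univ, forall_true_left,
      ZSpan.mem_fundamentalDomain]
    rfl
  have h1 := he.restrict_preimage hs
  rw [hpre, ← cellMeasure_one, Measure.restrict_smul] at h1
  have h2 : (volume : Measure (Fin 3 → ℝ)).restrict s =
      Measure.pi fun _ => (volume : Measure ℝ).restrict (Set.Ioc 0 (0 + 1)) := by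
    rw [volume_pi, Measure.restrict_pi_pi]
    congr 1
    funext i
    rw [zero_add]
    exact Measure.restrict_congr_set Ico_ae_eq_Ioc
  have h3 : MeasurePreserving (fun (a : Fin 3 → ℝ) (i : Fin 3) => ((a i : ℝ) : UnitAddCircle))
      ((volume : Measure (Fin 3 → ℝ)).restrict s) torusMeasure := by
    rw [h2]
    refine measurePreserving_pi _ _ fun i => ?_
    have := AddCircle.measurePreserving_mk 1 0
    rwa [AddCircle.volume_eq_smul_haarAddCircle, ENNReal.ofReal_one, one_smul] at this
  have h4 : MeasurePreserving (cellToTorus b) (cellMeasure b 1) (c • torusMeasure) :=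
    (h3.smul_measure (c : NNReal)).comp h1
  refine ⟨c, ?_, ENNReal.coe_ne_top, h4⟩
  have : c ≠ 0 := (Measure.addHaarScalarFactor_pos_of_isAddHaarMeasure _ _).ne'
  exact_mod_cast this

/-- The Lebesgue measure of the unit cell. -/
def cellVolume : ℝ≥0∞ := (exists_measurePreserving_cellToTorus b).choose

theorem cellVolume_ne_zero : cellVolume b ≠ 0 :=
  (exists_measurePreserving_cellToTorus b).choose_spec.1

theorem cellVolume_ne_top : cellVolume b ≠ ⊤ :=
  (exists_measurePreserving_cellToTorus b).choose_spec.2.1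

theorem measurePreserving_cellToTorus :
    MeasurePreserving (cellToTorus b) (cellMeasure b 1) (cellVolume b • torusMeasure) :=
  (exists_measurePreserving_cellToTorus b).choose_spec.2.2

theorem measurePreserving_torusToCell :
    MeasurePreserving (torusToCell b) torusMeasure ((cellVolume b)⁻¹ • cellMeasure b 1) := by
  refine ⟨measurable_torusToCell b, ?_⟩
  have h := (measurePreserving_cellToTorus b).map_eq
  have h2 : (cellVolume b • torusMeasure).map (torusToCell b) = cellMeasure b 1 := by
    rw [← h, Measure.map_map (measurable_torusToCell b) (measurable_cellToTorus b)]
    have : (torusToCell b ∘ cellToTorus b) =ᵐ[cellMeasure b 1] id := by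
      filter_upwards [ae_mem_fundamentalDomain b] with x hx
      exact torusToCell_cellToTorus b hx
    rw [Measure.map_congr this, Measure.map_id]
  rw [Measure.map_smul] at h2
  rw [← h2, smul_smul, ENNReal.inv_mul_cancel (cellVolume_ne_zero b) (cellVolume_ne_top b),
    one_smul]

/-! ### Composition with a map which preserves measures up to a factor -/

section CompScaled

variable {X Y E : Type*} [MeasurableSpace X] [MeasurableSpace Y] {μ : Measure X} {ν : Measure Y}
  [NormedAddCommGroup E] {c : ℝ≥0∞} {φ : X → Y}

theorem memLp_comp_of_measurePreserving_smul (hc : c ≠ ⊤) (hφ : MeasurePreserving φ μ (c • ν))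
    (f : Lp E 2 ν) : MemLp (f ∘ φ) 2 μ :=
  ((Lp.memLp f).smul_measure hc).comp_measurePreserving hφ

theorem ae_comp_of_measurePreserving_smul (hφ : MeasurePreserving φ μ (c • ν))
    {p : Y → Prop} (hp : ∀ᵐ y ∂ν, p y) : ∀ᵐ x ∂μ, p (φ x) :=
  hφ.quasiMeasurePreserving.ae (Measure.ae_smul_measure hp c)

variable [NormedSpace ℝ E]

/-- Composition of square integrable functions with a map `φ` which preserves the measures up to a
factor. -/
def compScaled (hc : c ≠ ⊤) (hφ : MeasurePreserving φ μ (c • ν)) : Lp E 2 ν →L[ℝ] Lp E 2 μ :=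
  LinearMap.mkContinuous
    { toFun := fun f => (memLp_comp_of_measurePreserving_smul hc hφ f).toLp _
      map_add' := by
        intro f g
        rw [← MemLp.toLp_add]
        refine MemLp.toLp_congr _ _ ?_
        exact ae_comp_of_measurePreserving_smul hφ (Lp.coeFn_add f g)
      map_smul' := by
        intro r f
        rw [RingHom.id_apply, ← MemLp.toLp_const_smul]
        refine MemLp.toLp_congr _ _ ?_
        exact ae_comp_of_measurePreserving_smul hφ (Lp.coeFn_smul r f) }
    (c ^ (1 / (2 : ℝ≥0∞)).toReal).toReal (by
      intro f
      simp only [LinearMap.coe_mk, AddHom.coe_mk]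
      rw [Lp.norm_toLp, Lp.norm_def, eLpNorm_comp_measurePreserving
        ((Lp.memLp f).smul_measure hc).1 hφ, eLpNorm_smul_measure_of_ne_top (by norm_num),
        smul_eq_mul, ENNReal.toReal_mul])

theorem coeFn_compScaled (hc : c ≠ ⊤) (hφ : MeasurePreserving φ μ (c • ν)) (f : Lp E 2 ν) :
    compScaled hc hφ f =ᵐ[μ] f ∘ φ :=
  MemLp.coeFn_toLp (memLp_comp_of_measurePreserving_smul hc hφ f)

end CompScaled

theorem inv_cellVolume_ne_top : (cellVolume b)⁻¹ ≠ ⊤ :=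
  ENNReal.inv_ne_top.2 (cellVolume_ne_zero b)

/-- A real function on the cell as a complex function on the torus. -/
def toTorus : PeriodicL2 b 1 →L[ℝ] Lp ℂ 2 torusMeasure :=
  (Complex.ofRealCLM.compLpL 2 torusMeasure).comp
    (compScaled (inv_cellVolume_ne_top b) (measurePreserving_torusToCell b))

/-- The real part of a complex function on the torus, as a function on the cell. -/
def ofTorus : Lp ℂ 2 torusMeasure →L[ℝ] PeriodicL2 b 1 :=
  (Complex.reCLM.compLpL 2 (cellMeasure b 1)).comp
    (compScaled (cellVolume_ne_top b) (measurePreserving_cellToTorus b))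

theorem coeFn_toTorus (f : PeriodicL2 b 1) :
    toTorus b f =ᵐ[torusMeasure] fun t => (f (torusToCell b t) : ℂ) := by
  refine (ContinuousLinearMap.coeFn_compLpL _ _).trans ?_
  filter_upwards [coeFn_compScaled (inv_cellVolume_ne_top b)
    (measurePreserving_torusToCell b) f] with t ht
  exact congrArg _ ht

theorem coeFn_ofTorus (g : Lp ℂ 2 torusMeasure) :
    ofTorus b g =ᵐ[cellMeasure b 1] fun x => (g (cellToTorus b x)).re := by
  refine (ContinuousLinearMap.coeFn_compLpL _ _).trans ?_
  filter_upwards [coeFn_compScaled (cellVolume_ne_top b)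
    (measurePreserving_cellToTorus b) g] with t ht
  exact congrArg _ ht

theorem ofTorus_toTorus (f : PeriodicL2 b 1) : ofTorus b (toTorus b f) = f := by
  refine Lp.ext ?_
  filter_upwards [coeFn_ofTorus b (toTorus b f), ae_mem_fundamentalDomain b,
    ae_comp_of_measurePreserving_smul (measurePreserving_cellToTorus b) (coeFn_toTorus b f)]
    with x h1 h2 h3
  rw [h1, h3, torusToCell_cellToTorus b h2, Complex.ofReal_re]

theorem integral_torus (F : Torus3 → ℂ) :
    ∫ x, F (cellToTorus b x) ∂(cellMeasure b 1) =
      (cellVolume b).toReal * ∫ t, F t ∂torusMeasure := by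
  have h := (measurePreserving_torusToCell b)
  have h1 : cellMeasure b 1 = cellVolume b • torusMeasure.map (torusToCell b) := by
    rw [h.map_eq, smul_smul, ENNReal.mul_inv_cancel (cellVolume_ne_zero b) (cellVolume_ne_top b),
      one_smul]
  have hemb : MeasurableEmbedding (torusToCell b) :=
    (measurable_torusToCell b).measurableEmbedding
      (Function.LeftInverse.injective (cellToTorus_torusToCell b))
  rw [h1, integral_smul_measure, hemb.integral_map]
  simp only [cellToTorus_torusToCell, Complex.real_smul]

end

/-! ### Fourier coefficients of periodic functions -/

section

/-- Square summable families of complex Fourier coefficients. -/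
abbrev FourierSeq : Type := lp (fun _ : Fin 3 → ℤ => ℂ) 2

/-- The Hilbert basis of exponential monomials on the torus. -/
def torusBasis : HilbertBasis (Fin 3 → ℤ) ℂ (Lp ℂ 2 torusMeasure) :=
  UnitAddTorus.mFourierBasis

theorem torusBasis_repr (g : Lp ℂ 2 torusMeasure) (k : Fin 3 → ℤ) :
    torusBasis.repr g k = ∫ t, conj (UnitAddTorus.mFourier k t) * g t ∂torusMeasure := by
  refine (UnitAddTorus.mFourierBasis_repr g k).trans ?_
  simp only [UnitAddTorus.mFourierCoeff, UnitAddTorus.mFourier_neg, smul_eq_mul]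
  rfl

theorem coeFn_torusBasis (k : Fin 3 → ℤ) :
    torusBasis k =ᵐ[torusMeasure] UnitAddTorus.mFourier k := by
  have h : torusBasis k = UnitAddTorus.mFourierLp 2 k :=
    congrFun UnitAddTorus.coe_mFourierBasis k
  rw [h]
  exact UnitAddTorus.coeFn_mFourierLp 2 k

variable (b : Module.Basis (Fin 3) ℝ E3)

/-- The linear form `x ↦ ⟨k, x⟩`, where `k` is the element of the reciprocal lattice with integer
coordinates `k`, so that `e^{i⟨k, x⟩}` is periodic. -/
def phase (k : Fin 3 → ℤ) : E3 →L[ℝ] ℝ :=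
  LinearMap.toContinuousLinearMap (∑ l, (2 * Real.pi * k l) • b.coord l)

theorem phase_apply (k : Fin 3 → ℤ) (x : E3) :
    phase b k x = ∑ l, 2 * Real.pi * k l * b.repr x l := by
  simp [phase]

theorem phase_neg (k : Fin 3 → ℤ) (x : E3) : phase b (-k) x = -phase b k x := by
  simp [phase_apply, ← Finset.sum_neg_distrib]

theorem mFourier_cellToTorus (k : Fin 3 → ℤ) (x : E3) :
    UnitAddTorus.mFourier k (cellToTorus b x) = Complex.exp (Complex.I * phase b k x) := by
  simp only [UnitAddTorus.mFourier, ContinuousMap.coe_mk, cellToTorus, fourier_coe_apply,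
    ← Complex.exp_sum, phase_apply]
  congr 1
  push_cast
  rw [Finset.mul_sum]
  refine Finset.sum_congr rfl fun i _ => ?_
  ring

/-- The Fourier coefficients of a periodic square integrable function. -/
def fourierSeq : PeriodicL2 b 1 →L[ℝ] FourierSeq :=
  ((torusBasis.repr.toContinuousLinearEquiv : Lp ℂ 2 torusMeasure →L[ℂ] FourierSeq).restrictScalars
    ℝ).comp (toTorus b)

/-- The real part of the Fourier series with given coefficients. -/
def synth : FourierSeq →L[ℝ] PeriodicL2 b 1 :=
  (ofTorus b).comp
    ((torusBasis.repr.symm.toContinuousLinearEquiv : FourierSeq →L[ℂ] Lp ℂ 2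
      torusMeasure).restrictScalars ℝ)

theorem fourierSeq_eq (f : PeriodicL2 b 1) : fourierSeq b f = torusBasis.repr (toTorus b f) := rfl

theorem synth_eq (a : FourierSeq) : synth b a = ofTorus b (torusBasis.repr.symm a) := rfl

theorem synth_fourierSeq (f : PeriodicL2 b 1) : synth b (fourierSeq b f) = f := by
  rw [synth_eq, fourierSeq_eq, LinearIsometryEquiv.symm_apply_apply, ofTorus_toTorus]

theorem fourierSeq_injective : Function.Injective (fourierSeq b) :=
  Function.LeftInverse.injective (synth_fourierSeq b)

theorem ext_fourierSeq {f g : PeriodicL2 b 1} (h : ∀ k, fourierSeq b f k = fourierSeq b g k) :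
    f = g :=
  fourierSeq_injective b (lp.ext (funext h))

theorem fourierSeq_apply_torus (f : PeriodicL2 b 1) (k : Fin 3 → ℤ) :
    fourierSeq b f k =
      ∫ t, conj (UnitAddTorus.mFourier k t) * (f (torusToCell b t) : ℂ) ∂torusMeasure := by
  rw [fourierSeq_eq, torusBasis_repr]
  refine integral_congr_ae ?_
  filter_upwards [coeFn_toTorus b f] with t ht
  rw [ht]

theorem fourierSeq_apply (f : PeriodicL2 b 1) (k : Fin 3 → ℤ) :
    (cellVolume b).toReal * fourierSeq b f k =
      ∫ x, Complex.exp (-(Complex.I * phase b k x)) * (f x : ℂ) ∂(cellMeasure b 1) := by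
  rw [fourierSeq_apply_torus, ← integral_torus b]
  refine integral_congr_ae ?_
  filter_upwards [ae_mem_fundamentalDomain b] with x hx
  rw [torusToCell_cellToTorus b hx, mFourier_cellToTorus, ← Complex.exp_conj, map_mul,
    Complex.conj_I, Complex.conj_ofReal, neg_mul]

theorem cellVolume_toReal_pos : 0 < (cellVolume b).toReal :=
  ENNReal.toReal_pos (cellVolume_ne_zero b) (cellVolume_ne_top b)

theorem fourierSeq_neg (f : PeriodicL2 b 1) (k : Fin 3 → ℤ) :
    fourierSeq b f (-k) = conj (fourierSeq b f k) := by
  simp only [fourierSeq_apply_torus]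
  rw [← integral_conj]
  simp [UnitAddTorus.mFourier_neg]

/-- Taking the real part of a Fourier series symmetrises its coefficients. -/
theorem fourierSeq_synth (a : FourierSeq) (k : Fin 3 → ℤ) :
    fourierSeq b (synth b a) k = (a k + conj (a (-k))) / 2 := by
  set g := torusBasis.repr.symm a with hg
  have ha : ∀ k, a k = ∫ t, conj (UnitAddTorus.mFourier k t) * g t ∂torusMeasure := by
    intro k
    rw [← torusBasis_repr, hg, LinearIsometryEquiv.apply_symm_apply]
  have hint : ∀ k, Integrable (fun t => conj (UnitAddTorus.mFourier k t) * g t) torusMeasure := by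
    intro k
    refine ((Lp.memLp g).integrable (by norm_num)).bdd_mul (c := 1) ?_ ?_
    · exact (Complex.continuous_conj.comp
        (UnitAddTorus.mFourier k).continuous).aestronglyMeasurable
    · refine Filter.Eventually.of_forall fun t => ?_
      rw [RCLike.norm_conj]
      exact ((UnitAddTorus.mFourier k).norm_coe_le_norm t).trans UnitAddTorus.mFourier_norm.le
  rw [fourierSeq_apply_torus, synth_eq, ← hg, ha k, ha (-k), ← integral_conj,
    ← integral_add (hint k), ← integral_div]
  · refine integral_congr_ae ?_
    filter_upwards [ae_comp_of_measurePreserving_smul (measurePreserving_torusToCell b)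
      (coeFn_ofTorus b g)] with t ht
    rw [ht, cellToTorus_torusToCell, UnitAddTorus.mFourier_neg, Complex.conj_conj, map_mul,
      ← mul_add, Complex.add_conj]
    push_cast
    ring
  · have := (RCLike.conjCLE (K := ℂ)).toContinuousLinearMap.integrable_comp (hint (-k))
    exact this

/-- Parseval's identity on the unit cell. -/
theorem integral_mul_eq_inner_fourierSeq (f g : PeriodicL2 b 1) :
    ((∫ x, f x * g x ∂(cellMeasure b 1) : ℝ) : ℂ) =
      (cellVolume b).toReal * inner ℂ (fourierSeq b f) (fourierSeq b g) := by
  rw [fourierSeq_eq, fourierSeq_eq, LinearIsometryEquiv.inner_map_map, L2.inner_def,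
    ← integral_torus b, ← integral_complex_ofReal]
  refine integral_congr_ae ?_
  filter_upwards [ae_mem_fundamentalDomain b,
    ae_comp_of_measurePreserving_smul (measurePreserving_cellToTorus b) (coeFn_toTorus b f),
    ae_comp_of_measurePreserving_smul (measurePreserving_cellToTorus b) (coeFn_toTorus b g)]
    with x hx hf hg
  rw [hf, hg, torusToCell_cellToTorus b hx]
  simp [mul_comm]

/-! ### Fourier multipliers -/

theorem sq_norm_mul_le {z w : ℂ} {C : ℝ} (hz : ‖z‖ ≤ C) : ‖z * w‖ ^ 2 ≤ C ^ 2 * ‖w‖ ^ 2 := by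
  rw [norm_mul, mul_pow]
  gcongr

theorem summable_sq_norm (a : FourierSeq) : Summable fun k => ‖a k‖ ^ 2 := by
  simpa using (lp.memℓp a).summable (by norm_num)

theorem sq_norm_fourierSeq (a : FourierSeq) : ‖a‖ ^ 2 = ∑' k, ‖a k‖ ^ 2 := by
  simpa using lp.norm_rpow_eq_tsum (p := 2) (by norm_num) a

theorem memℓp_diagonal {m : (Fin 3 → ℤ) → ℂ} {C : ℝ} (hm : ∀ k, ‖m k‖ ≤ C) (a : FourierSeq) :
    Memℓp (fun k => m k * a k) 2 := by
  refine memℓp_gen ?_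
  simpa using Summable.of_nonneg_of_le (fun k => by positivity)
    (fun k => sq_norm_mul_le (hm k)) ((summable_sq_norm a).mul_left (C ^ 2))

/-- Multiplication of a square summable family by a bounded family. -/
def diagonal (m : (Fin 3 → ℤ) → ℂ) (C : ℝ) (hm : ∀ k, ‖m k‖ ≤ C) : FourierSeq →L[ℝ] FourierSeq :=
  LinearMap.mkContinuous
    { toFun := fun a => ⟨fun k => m k * a k, memℓp_diagonal hm a⟩
      map_add' := fun a a' => lp.ext (funext fun k => mul_add _ _ _)
      map_smul' := fun r a => lp.ext (funext fun k => mul_smul_comm r (m k) (a k)) }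
    C (fun a => by
      have hC : 0 ≤ C := (norm_nonneg _).trans (hm 0)
      refine le_of_sq_le_sq ?_ (by positivity)
      rw [mul_pow, sq_norm_fourierSeq, sq_norm_fourierSeq, ← tsum_mul_left]
      exact Summable.tsum_le_tsum (fun k => sq_norm_mul_le (hm k)) (summable_sq_norm _)
        ((summable_sq_norm a).mul_left (C ^ 2)))

theorem diagonal_apply (m : (Fin 3 → ℤ) → ℂ) (C : ℝ) (hm : ∀ k, ‖m k‖ ≤ C) (a : FourierSeq)
    (k : Fin 3 → ℤ) : diagonal m C hm a k = m k * a k := rfl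

/-- The Fourier multiplier with bounded symbol `m` on real periodic functions. As `synth` takes real
parts, it multiplies Fourier coefficients by `m` only if `m (-k) = conj (m k)`. -/
def multiplier (m : (Fin 3 → ℤ) → ℂ) (C : ℝ) (hm : ∀ k, ‖m k‖ ≤ C) :
    PeriodicL2 b 1 →L[ℝ] PeriodicL2 b 1 :=
  (synth b).comp ((diagonal m C hm).comp (fourierSeq b))

theorem fourierSeq_multiplier (m : (Fin 3 → ℤ) → ℂ) (C : ℝ) (hm : ∀ k, ‖m k‖ ≤ C)
    (hsymm : ∀ k, m (-k) = conj (m k)) (f : PeriodicL2 b 1) (k : Fin 3 → ℤ) :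
    fourierSeq b (multiplier b m C hm f) k = m k * fourierSeq b f k := by
  simp only [multiplier, ContinuousLinearMap.comp_apply, fourierSeq_synth, diagonal_apply, hsymm,
    fourierSeq_neg, map_mul, Complex.conj_conj]
  ring

end

/-! ### Weak derivatives and Fourier coefficients -/

section

variable (b : Module.Basis (Fin 3) ℝ E3)

/-- The `j`-th Cartesian coordinate of the reciprocal lattice vector with integer coordinates
`k`. -/
def freq (k : Fin 3 → ℤ) (j : Fin 3) : ℝ := phase b k (EuclideanSpace.single j 1)

/-- The Fourier symbol `(iξ)^α` of `∂^α`. -/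
def symbol (α : Fin 3 → ℕ) (k : Fin 3 → ℤ) : ℂ := ∏ j, (Complex.I * freq b k j) ^ α j

theorem freq_neg (k : Fin 3 → ℤ) (j : Fin 3) : freq b (-k) j = -freq b k j := phase_neg b k _

theorem symbol_neg (α : Fin 3 → ℕ) (k : Fin 3 → ℤ) : symbol b α (-k) = conj (symbol b α k) := by
  simp [symbol, freq_neg, map_prod]

theorem symbol_zero (k : Fin 3 → ℤ) : symbol b 0 k = 1 := by simp [symbol]

theorem symbol_single (j : Fin 3) (m : ℕ) (k : Fin 3 → ℤ) :
    symbol b (Pi.single j m) k = (Complex.I * freq b k j) ^ m := by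
  unfold symbol
  rw [Finset.prod_eq_single j]
  · simp
  · intro i _ hi
    simp [Pi.single_eq_of_ne hi]
  · simp

theorem symbol_eq (α : Fin 3 → ℕ) (k : Fin 3 → ℤ) :
    symbol b α k = Complex.I ^ (∑ j, α j) * ((∏ j, freq b k j ^ α j : ℝ) : ℂ) := by
  simp [symbol, mul_pow, Finset.prod_mul_distrib, Finset.prod_pow_eq_pow_sum]

/-- The plane wave `cos(⟨k, x⟩ + θ)`. Differentiation shifts its phase by `π/2`. -/
def cosWave (k : Fin 3 → ℤ) (θ : ℝ) (x : E3) : ℝ := Real.cos (phase b k x + θ)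

theorem contDiff_cosWave (k : Fin 3 → ℤ) (θ : ℝ) : ContDiff ℝ ∞ (cosWave b k θ) :=
  Real.contDiff_cos.comp ((phase b k).contDiff.add contDiff_const)

theorem isPeriodic_of_basis {f : E3 → ℝ} {n : ℕ}
    (h : ∀ (l : Fin 3) (x : E3), f (x + (n : ℝ) • b l) = f x) : IsPeriodic b n f := by
  intro R hR
  induction hR using Submodule.span_induction with
  | mem R hR =>
    obtain ⟨l, rfl⟩ := hR
    exact h l
  | zero => simp
  | add R S _ _ h1 h2 => intro x; rw [smul_add, ← add_assoc, h2, h1]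
  | smul m R _ h1 =>
    have h2 : ∀ (p : ℕ) (x : E3), f (x + (n : ℝ) • ((p : ℤ) • R)) = f x := by
      intro p
      induction p with
      | zero => simp
      | succ p ih =>
        intro x
        rw [Nat.cast_succ, add_smul, one_smul, smul_add, ← add_assoc, h1, ih]
    intro x
    obtain ⟨p, rfl | rfl⟩ := m.eq_nat_or_neg
    · exact h2 p x
    · rw [← h2 p (x + (n : ℝ) • ((-(p : ℤ)) • R))]
      congr 1
      simp

theorem isPeriodic_cosWave (k : Fin 3 → ℤ) (θ : ℝ) : IsPeriodic b 1 (cosWave b k θ) := by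
  refine isPeriodic_of_basis b fun l x => ?_
  have : phase b k (b l) = k l * (2 * Real.pi) := by
    simp [phase_apply, Finsupp.single_apply]
    ring
  simp only [cosWave, Nat.cast_one, one_smul, map_add, this]
  rw [add_right_comm, Real.cos_add_int_mul_two_pi]

theorem partialDeriv_cosWave (j : Fin 3) (k : Fin 3 → ℤ) (c θ : ℝ) :
    partialDeriv j (fun x => c * cosWave b k θ x) =
      fun x => (c * freq b k j) * cosWave b k (θ + Real.pi / 2) x := by
  funext x
  have h : HasFDerivAt (fun x => c * cosWave b k θ x)
      (c • (-Real.sin (phase b k x + θ)) • (phase b k : E3 →L[ℝ] ℝ)) x :=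
    (((phase b k).hasFDerivAt.add_const θ).cos).const_mul c
  rw [partialDeriv, h.fderiv]
  simp only [smul_apply, smul_eq_mul, cosWave, ← add_assoc,
    Real.cos_add_pi_div_two, freq]
  ring

theorem iterate_partialDeriv_cosWave (j : Fin 3) (m : ℕ) (k : Fin 3 → ℤ) (c θ : ℝ) :
    (partialDeriv j)^[m] (fun x => c * cosWave b k θ x) =
      fun x => (c * freq b k j ^ m) * cosWave b k (θ + m * (Real.pi / 2)) x := by
  induction m with
  | zero => simp
  | succ m ih =>
    rw [Function.iterate_succ_apply', ih, partialDeriv_cosWave]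
    funext x
    push_cast
    ring_nf

theorem multiDeriv_cosWave (α : Fin 3 → ℕ) (k : Fin 3 → ℤ) (θ : ℝ) :
    multiDeriv α (cosWave b k θ) =
      fun x => (∏ j, freq b k j ^ α j) * cosWave b k (θ + (∑ j, α j : ℕ) * (Real.pi / 2)) x := by
  have h : cosWave b k θ = fun x => 1 * cosWave b k θ x := by simp
  rw [multiDeriv, h, iterate_partialDeriv_cosWave, iterate_partialDeriv_cosWave,
    iterate_partialDeriv_cosWave, Fin.sum_univ_three, Fin.prod_univ_three]
  funext x
  push_cast
  ring_nf

/-- Fourier coefficients are recovered by testing against the real waves `cosWave`. -/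
theorem integral_cosWave_add_I_mul (f : PeriodicL2 b 1) (k : Fin 3 → ℤ) (θ : ℝ) :
    ((∫ x, f x * cosWave b k θ x ∂(cellMeasure b 1) : ℝ) : ℂ) +
      Complex.I * ((∫ x, f x * cosWave b k (θ + Real.pi / 2) x ∂(cellMeasure b 1) : ℝ) : ℂ) =
      Complex.exp (-(Complex.I * θ)) * ((cellVolume b).toReal * fourierSeq b f k) := by
  rw [fourierSeq_apply, ← integral_const_mul, ← integral_complex_ofReal, ← integral_complex_ofReal,
    ← integral_const_mul, ← integral_add]
  · refine integral_congr_ae (Filter.Eventually.of_forall fun x => ?_)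
    simp only [cosWave, ← add_assoc, Real.cos_add_pi_div_two]
    rw [← mul_assoc, ← Complex.exp_add]
    have : -(Complex.I * (θ : ℂ)) + -(Complex.I * (phase b k x : ℂ)) =
        ((-(phase b k x + θ) : ℝ) : ℂ) * Complex.I := by push_cast; ring
    rw [this, Complex.exp_mul_I, ← Complex.ofReal_cos, ← Complex.ofReal_sin, Real.cos_neg,
      Real.sin_neg]
    push_cast
    ring
  · exact (integrable_mul_of_continuous b 1 f (contDiff_cosWave b k θ).continuous).ofReal
  · exact ((integrable_mul_of_continuous b 1 f
      (contDiff_cosWave b k (θ + Real.pi / 2)).continuous).ofReal).const_mul _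

theorem exp_neg_nat_mul_pi_div_two (m : ℕ) :
    Complex.exp (-(Complex.I * ((m * (Real.pi / 2) : ℝ) : ℂ))) = (-Complex.I) ^ m := by
  have : -(Complex.I * ((m * (Real.pi / 2) : ℝ) : ℂ)) =
      m * (-(Real.pi / 2 * Complex.I) : ℂ) := by push_cast; ring
  rw [this, Complex.exp_nat_mul, Complex.exp_neg, Complex.exp_pi_div_two_mul_I, Complex.inv_I]

variable {b}

theorem HasWeakDeriv.fourierSeq_eq {α : Fin 3 → ℕ} {f g : PeriodicL2 b 1}
    (h : HasWeakDeriv b 1 α f g) (k : Fin 3 → ℤ) :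
    fourierSeq b g k = symbol b α k * fourierSeq b f k := by
  set N := ∑ j, α j with hN
  set P := ∏ j, freq b k j ^ α j with hP
  have key : ∀ θ : ℝ, P * ∫ x, f x * cosWave b k (θ + N * (Real.pi / 2)) x ∂(cellMeasure b 1) =
      (-1) ^ N * ∫ x, g x * cosWave b k θ x ∂(cellMeasure b 1) := by
    intro θ
    rw [← h _ (contDiff_cosWave b k θ) (isPeriodic_cosWave b k θ), multiDeriv_cosWave,
      ← integral_const_mul]
    refine integral_congr_ae (Filter.Eventually.of_forall fun x => ?_)
    ring
  have h1 := integral_cosWave_add_I_mul b f k (N * (Real.pi / 2))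
  have h2 := integral_cosWave_add_I_mul b g k 0
  have k1 := congrArg (fun t : ℝ => (t : ℂ)) (key 0)
  have k2 := congrArg (fun t : ℝ => (t : ℂ)) (key (Real.pi / 2))
  rw [exp_neg_nat_mul_pi_div_two] at h1
  simp only [zero_add] at k1 h2
  rw [add_comm (Real.pi / 2)] at k2
  simp only [Complex.ofReal_mul, Complex.ofReal_pow, Complex.ofReal_neg, Complex.ofReal_one,
    Complex.ofReal_zero, mul_zero, neg_zero, Complex.exp_zero, one_mul] at k1 k2 h2
  have h3 : (cellVolume b).toReal * ((-1) ^ N * fourierSeq b g k) =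
      (cellVolume b).toReal * (P * (-Complex.I) ^ N * fourierSeq b f k) := by
    linear_combination (P : ℂ) * h1 - (-1) ^ N * h2 - k1 - Complex.I * k2
  have h4 := mul_left_cancel₀
    (Complex.ofReal_ne_zero.2 (cellVolume_toReal_pos b).ne') h3
  have h5 : ((-1 : ℂ) ^ N) * (-1) ^ N = 1 := by rw [← mul_pow]; simp
  rw [symbol_eq, ← hN, ← hP]
  rw [neg_pow] at h4
  linear_combination (-1) ^ N * h4 + (Complex.I ^ N * P * fourierSeq b f k - fourierSeq b g k) * h5

theorem HasWeakDeriv.unique {α : Fin 3 → ℕ} {f g g' : PeriodicL2 b 1}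
    (h : HasWeakDeriv b 1 α f g) (h' : HasWeakDeriv b 1 α f g') : g = g' :=
  ext_fourierSeq b fun k => by rw [h.fourierSeq_eq, h'.fourierSeq_eq]

/-! ### Integration by parts -/

theorem IsPeriodic.mul {n : ℕ} {f g : E3 → ℝ} (hf : IsPeriodic b n f) (hg : IsPeriodic b n g) :
    IsPeriodic b n fun x => f x * g x :=
  fun R hR x => congrArg₂ (· * ·) (hf R hR x) (hg R hR x)

theorem IsPeriodic.partialDeriv {n : ℕ} {f : E3 → ℝ} (hf : IsPeriodic b n f) (j : Fin 3) :
    IsPeriodic b n (partialDeriv j f) := by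
  intro R hR x
  have h : (fun y => f (y + (n : ℝ) • R)) = f := funext (hf R hR)
  have h2 := fderiv_comp_add_right (𝕜 := ℝ) (f := f) (x := x) ((n : ℝ) • R)
  rw [h] at h2
  simp only [TFDW.partialDeriv, h2]

theorem IsPeriodic.iterate_partialDeriv {n : ℕ} {f : E3 → ℝ} (hf : IsPeriodic b n f) (j : Fin 3)
    (m : ℕ) : IsPeriodic b n ((TFDW.partialDeriv j)^[m] f) := by
  induction m with
  | zero => exact hf
  | succ m ih => rw [Function.iterate_succ_apply']; exact ih.partialDeriv j

theorem IsPeriodic.apply_fract {f : E3 → ℝ} (hf : IsPeriodic b 1 f) (x : E3) :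
    f (ZSpan.fract b x) = f x := by
  have h := hf (-(ZSpan.floor b x : E3)) (Submodule.neg_mem _ (ZSpan.floor b x).2) x
  rwa [Nat.cast_one, one_smul, ← sub_eq_add_neg] at h

theorem IsPeriodic.exists_bound {f : E3 → ℝ} (hf : IsPeriodic b 1 f) (hc : Continuous f) :
    ∃ C, ∀ x, ‖f x‖ ≤ C := by
  have hK := (ZSpan.fundamentalDomain_isBounded b).isCompact_closure
  obtain ⟨C, hC⟩ := hK.exists_bound_of_continuousOn hc.continuousOn
  refine ⟨C, fun x => ?_⟩
  rw [← hf.apply_fract x]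
  exact hC _ (subset_closure (ZSpan.fract_mem_fundamentalDomain b x))

theorem IsPeriodic.integral_add_right {f : E3 → ℝ} (hf : IsPeriodic b 1 f) (v : E3) :
    ∫ x, f (x + v) ∂(cellMeasure b 1) = ∫ x, f x ∂(cellMeasure b 1) := by
  have h1 := ZSpan.isAddFundamentalDomain' b (volume : Measure E3)
  have h2 := h1.vadd_of_comm v
  have h3 : ∀ (R : (Submodule.span ℤ (Set.range b)).toAddSubgroup) (x : E3), f (R +ᵥ x) = f x := by
    intro R x
    have := hf R R.2 x
    rwa [Nat.cast_one, one_smul, add_comm] at this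
  have : Countable (Submodule.span ℤ (Set.range b)).toAddSubgroup :=
    inferInstanceAs (Countable (Submodule.span ℤ (Set.range b)))
  rw [cellMeasure_one, h1.setIntegral_eq h2 h3]
  have h4 := (measurePreserving_add_right (volume : Measure E3) v).setIntegral_image_emb
    (measurableEmbedding_addRight v) f (ZSpan.fundamentalDomain b)
  rw [← h4]
  congr 2
  ext x
  simp only [Set.mem_vadd_set, Set.mem_image, vadd_eq_add, add_comm]

theorem integral_partialDeriv_eq_zero {f : E3 → ℝ} (hf : IsPeriodic b 1 f) (hs : ContDiff ℝ ∞ f)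
    (j : Fin 3) : ∫ x, partialDeriv j f x ∂(cellMeasure b 1) = 0 := by
  have hd : ∀ x (t : ℝ), HasDerivAt (fun t : ℝ => f (x + t • EuclideanSpace.single j 1))
      (partialDeriv j f (x + t • EuclideanSpace.single j 1)) t := by
    intro x t
    have h1 : HasDerivAt (fun t : ℝ => x + t • (EuclideanSpace.single j (1 : ℝ) : E3))
        (EuclideanSpace.single j 1) t := by
      simpa using ((hasDerivAt_id t).smul_const (EuclideanSpace.single j (1 : ℝ) : E3)).const_add x
    exact ((hs.differentiable (by simp) _).hasFDerivAt).comp_hasDerivAt t h1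
  obtain ⟨C, hC⟩ := (hf.partialDeriv j).exists_bound (contDiff_partialDeriv j hs).continuous
  obtain ⟨C', hC'⟩ := hf.exists_bound hs.continuous
  have h := hasDerivAt_integral_of_dominated_loc_of_deriv_le (μ := cellMeasure b 1)
    (F := fun (t : ℝ) x => f (x + t • EuclideanSpace.single j 1))
    (F' := fun (t : ℝ) x => partialDeriv j f (x + t • EuclideanSpace.single j 1))
    (x₀ := 0) (s := Set.univ) (bound := fun _ => C) Filter.univ_mem
    (Filter.Eventually.of_forall fun t =>
      (hs.continuous.comp (continuous_add_const _)).aestronglyMeasurable)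
    (by simpa using Integrable.of_bound hs.continuous.aestronglyMeasurable C'
          (Filter.Eventually.of_forall hC'))
    (by simpa using (contDiff_partialDeriv j hs).continuous.aestronglyMeasurable)
    (Filter.Eventually.of_forall fun x t _ => hC _) (integrable_const C)
    (Filter.Eventually.of_forall fun x t _ => hd x t)
  have h2 := h.2
  simp only [hf.integral_add_right, zero_smul, add_zero] at h2
  exact h2.unique (hasDerivAt_const _ _)

theorem integral_mul_partialDeriv {f g : E3 → ℝ} (hf : IsPeriodic b 1 f) (hfs : ContDiff ℝ ∞ f)
    (hg : IsPeriodic b 1 g) (hgs : ContDiff ℝ ∞ g) (j : Fin 3) :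
    ∫ x, f x * partialDeriv j g x ∂(cellMeasure b 1) =
      -∫ x, partialDeriv j f x * g x ∂(cellMeasure b 1) := by
  have h := integral_partialDeriv_eq_zero (hf.mul hg) (hfs.mul hgs) j
  have h1 : partialDeriv j (fun x => f x * g x) =
      fun x => f x * partialDeriv j g x + partialDeriv j f x * g x := by
    funext x
    have := (hfs.differentiable (by simp) x).hasFDerivAt.mul
      (hgs.differentiable (by simp) x).hasFDerivAt
    change fderiv ℝ (f * g) x _ = _
    rw [this.fderiv]
    simp [partialDeriv, mul_comm]
  have hint : ∀ {u v : E3 → ℝ}, IsPeriodic b 1 u → ContDiff ℝ ∞ u → IsPeriodic b 1 v →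
      ContDiff ℝ ∞ v → Integrable (fun x => u x * v x) (cellMeasure b 1) := by
    intro u v hu hus hv hvs
    obtain ⟨C, hC⟩ := (hu.mul hv).exists_bound (hus.mul hvs).continuous
    exact Integrable.of_bound (hus.mul hvs).continuous.aestronglyMeasurable C
      (Filter.Eventually.of_forall hC)
  rw [h1, integral_add (hint hf hfs (hg.partialDeriv j) (contDiff_partialDeriv j hgs))
    (hint (hf.partialDeriv j) (contDiff_partialDeriv j hfs) hg hgs)] at h
  linarith

theorem multiDeriv_single_one (j : Fin 3) (φ : E3 → ℝ) :
    multiDeriv (Pi.single j 1) φ = partialDeriv j φ := by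
  fin_cases j <;> simp [multiDeriv]

theorem memLp_of_isPeriodic {f : E3 → ℝ} (hf : IsPeriodic b 1 f) (hc : Continuous f) :
    MemLp f 2 (cellMeasure b 1) := by
  obtain ⟨C, hC⟩ := hf.exists_bound hc
  exact MemLp.of_bound hc.aestronglyMeasurable C (Filter.Eventually.of_forall hC)

theorem hasWeakDeriv_of_contDiff {w : E3 → ℝ} (hw : IsPeriodic b 1 w) (hs : ContDiff ℝ ∞ w)
    {f g : PeriodicL2 b 1} (hf : f =ᵐ[cellMeasure b 1] w) (j : Fin 3)
    (hg : g =ᵐ[cellMeasure b 1] partialDeriv j w) : HasWeakDeriv b 1 (Pi.single j 1) f g := by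
  intro φ hφ hper
  rw [multiDeriv_single_one]
  have h1 : ∫ x, f x * partialDeriv j φ x ∂(cellMeasure b 1) =
      ∫ x, w x * partialDeriv j φ x ∂(cellMeasure b 1) := by
    refine integral_congr_ae ?_
    filter_upwards [hf] with x hx
    rw [hx]
  have h2 : ∫ x, g x * φ x ∂(cellMeasure b 1) =
      ∫ x, partialDeriv j w x * φ x ∂(cellMeasure b 1) := by
    refine integral_congr_ae ?_
    filter_upwards [hg] with x hx
    rw [hx]
  rw [h1, h2, integral_mul_partialDeriv hw hs hper hφ]
  simp

theorem fourierSeq_iterate_partialDeriv {w : E3 → ℝ} (hw : IsPeriodic b 1 w) (hs : ContDiff ℝ ∞ w)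
    (j : Fin 3) (m : ℕ) (k : Fin 3 → ℤ) :
    fourierSeq b ((memLp_of_isPeriodic (hw.iterate_partialDeriv j m)
      (contDiff_iterate_partialDeriv j m hs).continuous).toLp _) k =
      (Complex.I * freq b k j) ^ m *
        fourierSeq b ((memLp_of_isPeriodic hw hs.continuous).toLp _) k := by
  induction m with
  | zero => simp
  | succ m ih =>
    rw [pow_succ', mul_assoc, ← ih, ← pow_one (Complex.I * (freq b k j : ℂ)), ← symbol_single]
    refine HasWeakDeriv.fourierSeq_eq ?_ k
    refine hasWeakDeriv_of_contDiff (hw.iterate_partialDeriv j m)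
      (contDiff_iterate_partialDeriv j m hs) (MemLp.coeFn_toLp _) j ?_
    refine (MemLp.coeFn_toLp _).trans ?_
    rw [Function.iterate_succ_apply']

theorem IsPeriodic.multiDeriv {w : E3 → ℝ} (hw : IsPeriodic b 1 w) (α : Fin 3 → ℕ) :
    IsPeriodic b 1 (multiDeriv α w) :=
  ((hw.iterate_partialDeriv _ _).iterate_partialDeriv _ _).iterate_partialDeriv _ _

theorem fourierSeq_multiDeriv {w : E3 → ℝ} (hw : IsPeriodic b 1 w) (hs : ContDiff ℝ ∞ w)
    (α : Fin 3 → ℕ) (k : Fin 3 → ℤ) :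
    fourierSeq b ((memLp_of_isPeriodic (hw.multiDeriv α)
      (contDiff_multiDeriv α hs).continuous).toLp _) k =
      symbol b α k * fourierSeq b ((memLp_of_isPeriodic hw hs.continuous).toLp _) k := by
  unfold multiDeriv
  rw [fourierSeq_iterate_partialDeriv ((hw.iterate_partialDeriv 2 _).iterate_partialDeriv 1 _)
      (contDiff_iterate_partialDeriv _ _ (contDiff_iterate_partialDeriv _ _ hs)),
    fourierSeq_iterate_partialDeriv (hw.iterate_partialDeriv 2 _)
      (contDiff_iterate_partialDeriv _ _ hs),
    fourierSeq_iterate_partialDeriv hw hs, symbol, Fin.prod_univ_three]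
  ring

theorem inner_I_pow_mul (z w : ℂ) (N : ℕ) (P : ℝ) :
    inner ℂ z (Complex.I ^ N * P * w) = (-1) ^ N * inner ℂ (Complex.I ^ N * P * z) w := by
  have h5 : ((-1 : ℂ) ^ N) * (-1) ^ N = 1 := by rw [← mul_pow]; simp
  simp only [RCLike.inner_apply, map_mul, map_pow, Complex.conj_I, Complex.conj_ofReal,
    neg_pow Complex.I]
  linear_combination (-(Complex.I ^ N * P * conj z * w)) * h5

/-- Weak derivatives are characterised by their Fourier coefficients. -/
theorem hasWeakDeriv_iff {α : Fin 3 → ℕ} {f g : PeriodicL2 b 1} :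
    HasWeakDeriv b 1 α f g ↔ ∀ k, fourierSeq b g k = symbol b α k * fourierSeq b f k := by
  refine ⟨HasWeakDeriv.fourierSeq_eq, fun h φ hφ hper => ?_⟩
  set p := (memLp_of_isPeriodic hper hφ.continuous).toLp φ with hp
  set q := (memLp_of_isPeriodic (hper.multiDeriv α) (contDiff_multiDeriv α hφ).continuous).toLp
    (multiDeriv α φ) with hq
  have h1 : ∫ x, f x * multiDeriv α φ x ∂(cellMeasure b 1) =
      ∫ x, f x * q x ∂(cellMeasure b 1) := by
    refine integral_congr_ae ?_
    filter_upwards [MemLp.coeFn_toLp (memLp_of_isPeriodic (hper.multiDeriv α)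
      (contDiff_multiDeriv α hφ).continuous)] with x hx
    rw [hq, hx]
  have h2 : ∫ x, g x * φ x ∂(cellMeasure b 1) = ∫ x, g x * p x ∂(cellMeasure b 1) := by
    refine integral_congr_ae ?_
    filter_upwards [MemLp.coeFn_toLp (memLp_of_isPeriodic hper hφ.continuous)] with x hx
    rw [hp, hx]
  rw [h1, h2]
  have h3 : (inner ℂ (fourierSeq b f) (fourierSeq b q) : ℂ) =
      (-1) ^ (∑ j, α j) * inner ℂ (fourierSeq b g) (fourierSeq b p) := by
    rw [lp.inner_eq_tsum, lp.inner_eq_tsum, ← tsum_mul_left]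
    refine tsum_congr fun k => ?_
    rw [hq, fourierSeq_multiDeriv hper hφ, h k, symbol_eq]
    exact inner_I_pow_mul _ _ _ _
  have h4 := integral_mul_eq_inner_fourierSeq b f q
  rw [h3] at h4
  have h5 := integral_mul_eq_inner_fourierSeq b g p
  apply Complex.ofReal_injective
  rw [h4, Complex.ofReal_mul, h5]
  push_cast
  ring

end

/-! ### The Sobolev embedding -/

section

variable (b : Module.Basis (Fin 3) ℝ E3)

/-- The symbol `1 + |ξ|²` of `1 - Δ`. -/
def resolventSymbol (k : Fin 3 → ℤ) : ℝ := 1 + ∑ j, freq b k j ^ 2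

theorem one_le_resolventSymbol (k : Fin 3 → ℤ) : 1 ≤ resolventSymbol b k :=
  le_add_of_nonneg_right (Finset.sum_nonneg fun _ _ => sq_nonneg _)

theorem resolventSymbol_pos (k : Fin 3 → ℤ) : 0 < resolventSymbol b k :=
  zero_lt_one.trans_le (one_le_resolventSymbol b k)

theorem resolventSymbol_ne_zero (k : Fin 3 → ℤ) : (resolventSymbol b k : ℂ) ≠ 0 :=
  Complex.ofReal_ne_zero.2 (resolventSymbol_pos b k).ne'

theorem resolventSymbol_neg (k : Fin 3 → ℤ) : resolventSymbol b (-k) = resolventSymbol b k := by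
  simp [resolventSymbol, freq_neg]

theorem abs_freq_le (k : Fin 3 → ℤ) (j : Fin 3) : |freq b k j| ≤ √(resolventSymbol b k) := by
  refine Real.abs_le_sqrt ?_
  have := Finset.single_le_sum (f := fun j => freq b k j ^ 2) (fun _ _ => sq_nonneg _)
    (Finset.mem_univ j)
  simp only [resolventSymbol] at *
  linarith

theorem freq_sum_mul (k : Fin 3 → ℤ) (l : Fin 3) :
    ∑ j, (b l) j * freq b k j = 2 * Real.pi * k l := by
  have h1 : phase b k (b l) = 2 * Real.pi * k l := by
    simp [phase_apply, Finsupp.single_apply]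
  have h2 : b l = ∑ j, (b l) j • (EuclideanSpace.single j (1 : ℝ) : E3) := by
    ext i
    simp [Finset.sum_apply, Pi.single_apply]
  conv_rhs => rw [← h1, h2]
  simp [freq]

theorem exists_norm_latticePoint_le :
    ∃ C : ℝ, 0 < C ∧ ∀ k : Fin 3 → ℤ, ‖∑ l, k l • b l‖ ≤ C * √(resolventSymbol b k) := by
  refine ⟨1 + ∑ l, (∑ j, |(b l) j|) * ‖b l‖, by positivity, fun k => ?_⟩
  have hk : ∀ l, |(k l : ℝ)| ≤ (∑ j, |(b l) j|) * √(resolventSymbol b k) := by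
    intro l
    calc |(k l : ℝ)| ≤ (2 * Real.pi) * |(k l : ℝ)| := by
          refine le_mul_of_one_le_left (abs_nonneg _) ?_
          linarith [Real.pi_gt_three]
      _ = |∑ j, (b l) j * freq b k j| := by
          rw [freq_sum_mul, abs_mul, abs_of_pos Real.two_pi_pos]
      _ ≤ ∑ j, |(b l) j * freq b k j| := Finset.abs_sum_le_sum_abs _ _
      _ ≤ ∑ j, |(b l) j| * √(resolventSymbol b k) := by
          refine Finset.sum_le_sum fun j _ => ?_
          rw [abs_mul]
          gcongr
          exact abs_freq_le b k j
      _ = _ := by rw [Finset.sum_mul]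
  calc ‖∑ l, k l • b l‖ ≤ ∑ l, ‖k l • b l‖ := norm_sum_le _ _
    _ ≤ ∑ l, ((∑ j, |(b l) j|) * ‖b l‖) * √(resolventSymbol b k) := by
        refine Finset.sum_le_sum fun l _ => ?_
        rw [← Int.cast_smul_eq_zsmul ℝ, norm_smul, Real.norm_eq_abs, mul_right_comm]
        gcongr
        exact hk l
    _ ≤ (1 + ∑ l, (∑ j, |(b l) j|) * ‖b l‖) * √(resolventSymbol b k) := by
        rw [← Finset.sum_mul]
        gcongr
        linarith

/-- `∑ₖ (1 + |ξₖ|²)⁻²` converges in dimension three; this is what makes `H²` embed into the bounded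
continuous functions. -/
theorem summable_inv_resolventSymbol_sq : Summable fun k => ((resolventSymbol b k)⁻¹) ^ 2 := by
  obtain ⟨C, hC, h⟩ := exists_norm_latticePoint_le b
  let L := Submodule.span ℤ (Set.range b)
  let z : (Fin 3 → ℤ) → L := fun k => ⟨∑ l, k l • b l, Submodule.sum_mem _ fun l _ =>
    Submodule.smul_mem _ _ (Submodule.subset_span ⟨l, rfl⟩)⟩
  have hz : Function.Injective z := by
    intro k k' hkk
    have h1 : ∑ l, k l • b l = ∑ l, k' l • b l := congrArg Subtype.val hkk
    funext l
    have h2 := congrArg (fun v => b.repr v l) h1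
    simp only [← Int.cast_smul_eq_zsmul ℝ] at h2
    simpa [Finsupp.single_apply] using h2
  have hrank : Module.finrank ℤ L < 4 := by
    have h3 := finrank_span_le_card (R := ℤ) (Set.range b)
    have h4 : (Set.range b).toFinset.card ≤ 3 := by
      rw [Set.toFinset_range]
      exact Finset.card_image_le.trans (by simp)
    exact (h3.trans h4).trans_lt (by norm_num)
  have hs := ((ZLattice.summable_norm_pow_inv L 4 hrank).comp_injective hz).mul_left (C ^ 4)
  refine Summable.of_norm_bounded_eventually hs ?_
  refine (Set.finite_singleton (0 : Fin 3 → ℤ)).subset fun k hk => ?_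
  by_contra hk0
  refine hk ?_
  have hz0 : 0 < ‖z k‖ := by
    rw [norm_pos_iff]
    intro h0
    exact hk0 (hz (h0.trans (by ext; simp [z])))
  have hr := resolventSymbol_pos b k
  have h5 : ‖z k‖ ≤ C * √(resolventSymbol b k) := h k
  have h6 : ‖z k‖ ^ 4 ≤ C ^ 4 * resolventSymbol b k ^ 2 := by
    calc ‖z k‖ ^ 4 ≤ (C * √(resolventSymbol b k)) ^ 4 := by gcongr
      _ = C ^ 4 * (√(resolventSymbol b k) ^ 2) ^ 2 := by ring
      _ = _ := by rw [Real.sq_sqrt hr.le]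
  change ‖((resolventSymbol b k)⁻¹) ^ 2‖ ≤ C ^ 4 * (‖z k‖⁻¹ ^ 4)
  rw [Real.norm_of_nonneg (by positivity)]
  rw [inv_pow, inv_pow, ← div_eq_mul_inv, le_div_iff₀ (by positivity),
    inv_mul_le_iff₀ (by positivity)]
  linarith

theorem norm_re_mul_exp_le (a : ℂ) (t : ℝ) : ‖(a * Complex.exp (Complex.I * t)).re‖ ≤ ‖a‖ := by
  refine (Complex.abs_re_le_norm _).trans ?_
  rw [norm_mul, mul_comm Complex.I, Complex.norm_exp_ofReal_mul_I, mul_one]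

/-- The bounded continuous function `x ↦ Re (a e^{i⟨k, x⟩})`. -/
def mode (k : Fin 3 → ℤ) : ℂ →L[ℝ] (E3 →ᵇ ℝ) :=
  LinearMap.mkContinuous
    { toFun := fun a => BoundedContinuousFunction.ofNormedAddCommGroup
        (fun x => (a * Complex.exp (Complex.I * phase b k x)).re) (by fun_prop) ‖a‖
        (fun _ => norm_re_mul_exp_le a _)
      map_add' := fun a a' => by ext x; simp [add_mul]
      map_smul' := fun r a => by ext x; simp [mul_assoc] }
    1 (fun a => by
      rw [one_mul]
      exact (BoundedContinuousFunction.norm_le (norm_nonneg a)).2 fun _ => norm_re_mul_exp_le a _)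

theorem mode_apply (k : Fin 3 → ℤ) (a : ℂ) (x : E3) :
    mode b k a x = (a * Complex.exp (Complex.I * phase b k x)).re := rfl

theorem norm_mode_le (k : Fin 3 → ℤ) (a : ℂ) : ‖mode b k a‖ ≤ ‖a‖ :=
  (BoundedContinuousFunction.norm_le (norm_nonneg a)).2 fun _ => norm_re_mul_exp_le a _

/-- The class in `L²` of a bounded continuous function. -/
def boundedToL2 : (E3 →ᵇ ℝ) →L[ℝ] PeriodicL2 b 1 :=
  BoundedContinuousFunction.toLp 2 (cellMeasure b 1) ℝ

theorem coeFn_boundedToL2 (w : E3 →ᵇ ℝ) : boundedToL2 b w =ᵐ[cellMeasure b 1] w :=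
  BoundedContinuousFunction.coeFn_toLp (p := 2) (cellMeasure b 1) ℝ w

theorem boundedToL2_mode (k : Fin 3 → ℤ) (a : ℂ) :
    boundedToL2 b (mode b k a) = synth b (lp.single 2 k a) := by
  have h : torusBasis.repr.symm (lp.single 2 k a) = a • torusBasis k := by
    rw [← torusBasis.repr_symm_single, ← map_smul, ← lp.single_smul, smul_eq_mul, mul_one]
  refine Lp.ext ?_
  rw [synth_eq, h]
  filter_upwards [coeFn_boundedToL2 b (mode b k a), coeFn_ofTorus b (a • torusBasis k),
    ae_comp_of_measurePreserving_smul (measurePreserving_cellToTorus b)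
      (Lp.coeFn_smul a (torusBasis k)),
    ae_comp_of_measurePreserving_smul (measurePreserving_cellToTorus b) (coeFn_torusBasis k)]
    with x h1 h2 h3 h4
  rw [h1, h2, h3, Pi.smul_apply, h4, mFourier_cellToTorus, smul_eq_mul, mode_apply]

theorem norm_inv_resolventSymbol_le (k : Fin 3 → ℤ) :
    ‖((resolventSymbol b k : ℂ))⁻¹‖ ≤ 1 := by
  rw [norm_inv, Complex.norm_real, Real.norm_of_nonneg (resolventSymbol_pos b k).le]
  exact inv_le_one_of_one_le₀ (one_le_resolventSymbol b k)

theorem summable_and_tsum_norm_le (g : PeriodicL2 b 1) :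
    (Summable fun k => ‖((resolventSymbol b k : ℂ))⁻¹ * fourierSeq b g k‖) ∧
    ∑' k, ‖((resolventSymbol b k : ℂ))⁻¹ * fourierSeq b g k‖ ≤
      √(∑' k, ((resolventSymbol b k)⁻¹) ^ 2) * ‖fourierSeq b g‖ := by
  have h0 : ∀ k, ‖((resolventSymbol b k : ℂ))⁻¹ * fourierSeq b g k‖ =
      (resolventSymbol b k)⁻¹ * ‖fourierSeq b g k‖ := by
    intro k
    rw [norm_mul, norm_inv, Complex.norm_real, Real.norm_of_nonneg (resolventSymbol_pos b k).le]
  simp only [h0]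
  have hconj : (2 : ℝ).HolderConjugate 2 := Real.HolderConjugate.two_two
  have hf : ∀ k, 0 ≤ (resolventSymbol b k)⁻¹ := fun k => (inv_pos.2 (resolventSymbol_pos b k)).le
  have s1 : Summable fun k => ((resolventSymbol b k)⁻¹) ^ (2 : ℝ) := by
    simpa using summable_inv_resolventSymbol_sq b
  have s2 : Summable fun k => ‖fourierSeq b g k‖ ^ (2 : ℝ) := by
    simpa using summable_sq_norm (fourierSeq b g)
  refine ⟨Real.summable_mul_of_Lp_Lq_of_nonneg hconj hf (fun _ => norm_nonneg _) s1 s2, ?_⟩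
  have h := Real.inner_le_Lp_mul_Lq_tsum_of_nonneg hconj hf (fun _ => norm_nonneg _) s1 s2
  refine h.trans (le_of_eq ?_)
  simp only [Real.rpow_two, ← sq_norm_fourierSeq, ← Real.sqrt_eq_rpow, Real.sqrt_sq (norm_nonneg _)]

/-- The Sobolev embedding: the bounded continuous representative of `(1 - Δ)⁻¹ g`. -/
def sobolevEmbedding : PeriodicL2 b 1 →L[ℝ] (E3 →ᵇ ℝ) :=
  LinearMap.mkContinuous
    { toFun := fun g => ∑' k, mode b k ((resolventSymbol b k : ℂ)⁻¹ * fourierSeq b g k)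
      map_add' := fun g g' => by
        rw [← Summable.tsum_add]
        · refine tsum_congr fun k => ?_
          rw [map_add, lp.coeFn_add, Pi.add_apply, mul_add, map_add]
        · exact Summable.of_norm_bounded (summable_and_tsum_norm_le b g).1
            fun k => norm_mode_le b k _
        · exact Summable.of_norm_bounded (summable_and_tsum_norm_le b g').1
            fun k => norm_mode_le b k _
      map_smul' := fun r g => by
        rw [RingHom.id_apply, ← tsum_const_smul'']
        refine tsum_congr fun k => ?_
        rw [map_smul, lp.coeFn_smul, Pi.smul_apply, mul_smul_comm, map_smul] }
    (√(∑' k, ((resolventSymbol b k)⁻¹) ^ 2) * ‖fourierSeq b‖) (fun g => by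
      refine (tsum_of_norm_bounded (summable_and_tsum_norm_le b g).1.hasSum
        fun k => norm_mode_le b k _).trans ?_
      refine (summable_and_tsum_norm_le b g).2.trans ?_
      rw [mul_assoc]
      gcongr
      exact (fourierSeq b).le_opNorm g)

theorem hasSum_sobolevEmbedding (g : PeriodicL2 b 1) :
    HasSum (fun k => mode b k ((resolventSymbol b k : ℂ)⁻¹ * fourierSeq b g k))
      (sobolevEmbedding b g) :=
  (Summable.of_norm_bounded (summable_and_tsum_norm_le b g).1 fun k => norm_mode_le b k _).hasSum

theorem hasSum_synth (a : FourierSeq) :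
    HasSum (fun k => boundedToL2 b (mode b k (a k))) (synth b a) := by
  simp only [boundedToL2_mode]
  exact (lp.hasSum_single (by norm_num) a).mapL (synth b)

theorem boundedToL2_sobolevEmbedding (g : PeriodicL2 b 1) :
    boundedToL2 b (sobolevEmbedding b g) =
      multiplier b (fun k => (resolventSymbol b k : ℂ)⁻¹) 1 (norm_inv_resolventSymbol_le b) g :=
  ((hasSum_sobolevEmbedding b g).mapL (boundedToL2 b)).unique
    (hasSum_synth b (diagonal _ 1 (norm_inv_resolventSymbol_le b) (fourierSeq b g)))

theorem fourierSeq_sobolevEmbedding (g : PeriodicL2 b 1) (k : Fin 3 → ℤ) :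
    fourierSeq b (boundedToL2 b (sobolevEmbedding b g)) k =
      (resolventSymbol b k : ℂ)⁻¹ * fourierSeq b g k := by
  rw [boundedToL2_sobolevEmbedding, fourierSeq_multiplier]
  intro k
  simp [resolventSymbol_neg]

end

/-! ### Periodic Sobolev spaces -/

section

variable {b : Module.Basis (Fin 3) ℝ E3}

theorem continuous_fourierSeq_apply (k : Fin 3 → ℤ) : Continuous fun f => fourierSeq b f k :=
  ((continuous_apply k).comp lp.uniformContinuous_coe.continuous).comp (fourierSeq b).continuous

namespace PeriodicSobolev

variable {m : ℕ}

theorem hasWeakDeriv (u : PeriodicSobolev b 1 m) (α : Fin 3 → ℕ) (hα : α ∈ multiIndices m) :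
    HasWeakDeriv b 1 α (toL2 u) (weakDeriv u α hα) := u.2 ⟨α, hα⟩

theorem fourierSeq_weakDeriv (u : PeriodicSobolev b 1 m) (α : Fin 3 → ℕ) (hα : α ∈ multiIndices m)
    (k : Fin 3 → ℤ) :
    fourierSeq b (weakDeriv u α hα) k = symbol b α k * fourierSeq b (toL2 u) k :=
  (hasWeakDeriv u α hα).fourierSeq_eq k

theorem ext_toL2 {u v : PeriodicSobolev b 1 m} (h : toL2 u = toL2 v) : u = v := by
  refine Subtype.ext (PiLp.ext fun α => ?_)
  refine (hasWeakDeriv u α α.2).unique ?_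
  rw [h]
  exact hasWeakDeriv v α α.2

instance : CompleteSpace (PeriodicSobolev b 1 m) := by
  have h : IsClosed (PeriodicSobolev b 1 m : Set (PiLp 1 fun _ : multiIndices m =>
      PeriodicL2 b 1)) := by
    have h1 : (PeriodicSobolev b 1 m : Set (PiLp 1 fun _ : multiIndices m => PeriodicL2 b 1)) =
        ⋂ (α : multiIndices m) (k : Fin 3 → ℤ), {F | fourierSeq b (F α) k =
          symbol b α k * fourierSeq b (F ⟨0, zero_mem_multiIndices m⟩) k} := by
      ext F
      simp only [Set.mem_iInter, Set.mem_ofPred_eq]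
      exact forall_congr' fun α => hasWeakDeriv_iff
    rw [h1]
    refine isClosed_iInter fun α => isClosed_iInter fun k => isClosed_eq ?_ ?_
    · exact (continuous_fourierSeq_apply k).comp (PiLp.continuous_apply 1 _ _)
    · exact continuous_const.mul
        ((continuous_fourierSeq_apply k).comp (PiLp.continuous_apply 1 _ _))
  exact h.completeSpace_coe

/-- The weak derivative `∂^α` as a bounded operator. -/
def weakDerivL (b : Module.Basis (Fin 3) ℝ E3) (m : ℕ) (α : Fin 3 → ℕ) (hα : α ∈ multiIndices m) :
    PeriodicSobolev b 1 m →L[ℝ] PeriodicL2 b 1 :=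
  (PiLp.proj 1 (fun _ : multiIndices m => PeriodicL2 b 1) ⟨α, hα⟩).comp
    (PeriodicSobolev b 1 m).subtypeL

theorem weakDerivL_apply (α : Fin 3 → ℕ) (hα : α ∈ multiIndices m) (u : PeriodicSobolev b 1 m) :
    weakDerivL b m α hα u = weakDeriv u α hα := rfl

/-- The operator `1 - Δ` from `Hᵐ`, `m ≥ 2`, to `L²`. -/
def oneSubLaplacian (b : Module.Basis (Fin 3) ℝ E3) (hm : 2 ≤ m) :
    PeriodicSobolev b 1 m →L[ℝ] PeriodicL2 b 1 :=
  weakDerivL b m 0 (zero_mem_multiIndices m) -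
    ∑ i, weakDerivL b m (Pi.single i 2) (single_two_mem_multiIndices hm i)

theorem oneSubLaplacian_apply (hm : 2 ≤ m) (u : PeriodicSobolev b 1 m) :
    oneSubLaplacian b hm u = toL2 u - laplacian hm u := by
  simp only [oneSubLaplacian, sub_apply, sum_apply,
    weakDerivL_apply]
  rfl

theorem coeFn_oneSubLaplacian (hm : 2 ≤ m) (u : PeriodicSobolev b 1 m) :
    ∀ᵐ x ∂(cellMeasure b 1), oneSubLaplacian b hm u x = toL2 u x - laplacian hm u x := by
  rw [oneSubLaplacian_apply]
  exact Lp.coeFn_sub _ _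

theorem fourierSeq_oneSubLaplacian (hm : 2 ≤ m) (u : PeriodicSobolev b 1 m) (k : Fin 3 → ℤ) :
    fourierSeq b (oneSubLaplacian b hm u) k =
      resolventSymbol b k * fourierSeq b (toL2 u) k := by
  have h : laplacian hm u = ∑ i, weakDeriv u (Pi.single i 2) (single_two_mem_multiIndices hm i) :=
    rfl
  rw [oneSubLaplacian_apply, h, map_sub, map_sum, lp.coeFn_sub, Pi.sub_apply, lp.coeFn_sum,
    Finset.sum_apply]
  simp only [fourierSeq_weakDeriv, symbol_single, resolventSymbol, mul_pow, Complex.I_sq]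
  push_cast
  rw [← Finset.sum_mul]
  simp only [neg_mul, one_mul, Finset.sum_neg_distrib]
  ring

end PeriodicSobolev

open PeriodicSobolev

theorem single_one_mem_multiIndices {m : ℕ} (hm : 2 ≤ m) (j : Fin 3) :
    (Pi.single j 1 : Fin 3 → ℕ) ∈ multiIndices m := by
  simp [mem_multiIndices]
  omega

/-! ### Continuous functions with square integrable gradient -/

/-- Pairs of a bounded continuous function and a candidate for its gradient in `L²`. -/
abbrev GradPair (b : Module.Basis (Fin 3) ℝ E3) : Type := (E3 →ᵇ ℝ) × (Fin 3 → PeriodicL2 b 1)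

/-- A smooth periodic function paired with its gradient. -/
def IsSmoothPair (d : GradPair b) : Prop :=
  ContDiff ℝ ∞ d.1 ∧ IsPeriodic b 1 d.1 ∧ ∀ j, d.2 j =ᵐ[cellMeasure b 1] partialDeriv j d.1

theorem partialDeriv_add (j : Fin 3) {f g : E3 → ℝ} (hf : ContDiff ℝ ∞ f) (hg : ContDiff ℝ ∞ g)
    (x : E3) : partialDeriv j (f + g) x = partialDeriv j f x + partialDeriv j g x := by
  simp [partialDeriv, fderiv_add (hf.differentiable (by simp) x) (hg.differentiable (by simp) x)]

theorem partialDeriv_const_smul (j : Fin 3) (r : ℝ) {f : E3 → ℝ} (hf : ContDiff ℝ ∞ f)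
    (x : E3) : partialDeriv j (r • f) x = r * partialDeriv j f x := by
  simp [partialDeriv, fderiv_const_smul (hf.differentiable (by simp) x)]

/-- The closure of the smooth periodic functions in the space of continuous functions with square
integrable gradient. Algebraic identities for gradients pass from smooth functions to this space by
continuity. -/
def gradClosure (b : Module.Basis (Fin 3) ℝ E3) : Submodule ℝ (GradPair b) :=
  Submodule.topologicalClosure
    { carrier := {d | IsSmoothPair d}
      zero_mem' := by
        refine ⟨contDiff_const, fun R _ x => rfl, fun j => ?_⟩
        filter_upwards [Lp.coeFn_zero ℝ 2 (cellMeasure b 1)] with x hx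
        have : ((0 : GradPair b).1 : E3 → ℝ) = fun _ => 0 := rfl
        simpa [partialDeriv, this] using hx
      add_mem' := by
        intro d e hd he
        refine ⟨hd.1.add he.1, fun R hR x => ?_, fun j => ?_⟩
        · exact congrArg₂ (· + ·) (hd.2.1 R hR x) (he.2.1 R hR x)
        · filter_upwards [hd.2.2 j, he.2.2 j, Lp.coeFn_add (d.2 j) (e.2 j)] with x h1 h2 h3
          have h4 := partialDeriv_add j hd.1 he.1 x
          rw [← h1, ← h2] at h4
          exact h3.trans h4.symm
      smul_mem' := by
        intro r d hd
        refine ⟨hd.1.const_smul r, fun R hR x => ?_, fun j => ?_⟩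
        · exact congrArg (r * ·) (hd.2.1 R hR x)
        · filter_upwards [hd.2.2 j, Lp.coeFn_smul r (d.2 j)] with x h1 h3
          have h4 := partialDeriv_const_smul j r hd.1 x
          rw [← h1] at h4
          exact h3.trans h4.symm }

theorem IsSmoothPair.mem_gradClosure {d : GradPair b} (hd : IsSmoothPair d) : d ∈ gradClosure b :=
  Submodule.le_topologicalClosure _ hd

theorem isClosed_gradClosure : IsClosed (gradClosure b : Set (GradPair b)) :=
  Submodule.isClosed_topologicalClosure _

theorem hasWeakDeriv_of_mem_gradClosure {d : GradPair b} (hd : d ∈ gradClosure b) (j : Fin 3) :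
    HasWeakDeriv b 1 (Pi.single j 1) (boundedToL2 b d.1) (d.2 j) := by
  rw [hasWeakDeriv_iff]
  intro k
  have hcl : IsClosed {d : GradPair b | fourierSeq b (d.2 j) k =
      symbol b (Pi.single j 1) k * fourierSeq b (boundedToL2 b d.1) k} := by
    refine isClosed_eq ?_ ?_
    · exact (continuous_fourierSeq_apply k).comp ((continuous_apply j).comp continuous_snd)
    · exact continuous_const.mul ((continuous_fourierSeq_apply k).comp
        ((boundedToL2 b).continuous.comp continuous_fst))
  have hd' : d ∈ closure {d : GradPair b | IsSmoothPair d} := hd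
  refine hcl.closure_subset_iff.2 ?_ hd'
  intro e he
  exact (hasWeakDeriv_of_contDiff he.2.1 he.1 (coeFn_boundedToL2 b e.1) j
    (he.2.2 j)).fourierSeq_eq k

theorem mode_eq_cosWave (k : Fin 3 → ℤ) (a : ℂ) (x : E3) :
    mode b k a x = a.re * cosWave b k 0 x + a.im * cosWave b k (Real.pi / 2) x := by
  rw [mode_apply, mul_comm Complex.I, Complex.exp_mul_I, ← Complex.ofReal_cos,
    ← Complex.ofReal_sin]
  simp only [cosWave, Real.cos_add_pi_div_two, add_zero, Complex.mul_re, Complex.add_re,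
    Complex.add_im, Complex.mul_im, Complex.ofReal_re, Complex.ofReal_im, Complex.I_re,
    Complex.I_im]
  ring

theorem contDiff_mode (k : Fin 3 → ℤ) (a : ℂ) : ContDiff ℝ ∞ (mode b k a) := by
  have : (mode b k a : E3 → ℝ) = _ := funext (mode_eq_cosWave k a)
  rw [this]
  exact (contDiff_const.mul (contDiff_cosWave b k _)).add
    (contDiff_const.mul (contDiff_cosWave b k _))

theorem partialDeriv_mode (j : Fin 3) (k : Fin 3 → ℤ) (a : ℂ) (x : E3) :
    partialDeriv j (mode b k a) x = mode b k (symbol b (Pi.single j 1) k * a) x := by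
  have : (mode b k a : E3 → ℝ) =
      (fun x => a.re * cosWave b k 0 x) + fun x => a.im * cosWave b k (Real.pi / 2) x :=
    funext (mode_eq_cosWave k a)
  rw [this, partialDeriv_add j (contDiff_const.mul (contDiff_cosWave b k _))
    (contDiff_const.mul (contDiff_cosWave b k _)), partialDeriv_cosWave, partialDeriv_cosWave,
    mode_eq_cosWave, symbol_single]
  simp [cosWave, Real.cos_add_pi_div_two]
  ring

theorem isSmoothPair_mode (k : Fin 3 → ℤ) (a : ℂ) :
    IsSmoothPair (b := b) (mode b k a,
      fun j => boundedToL2 b (mode b k (symbol b (Pi.single j 1) k * a))) := by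
  refine ⟨contDiff_mode k a, fun R hR x => ?_, fun j => ?_⟩
  · simp only [mode_eq_cosWave]
    rw [isPeriodic_cosWave b k _ R hR, isPeriodic_cosWave b k _ R hR]
  · filter_upwards [coeFn_boundedToL2 b (mode b k (symbol b (Pi.single j 1) k * a))] with x hx
    rw [hx, partialDeriv_mode]

/-- An element of `Hᵐ`, `m ≥ 2`, as a continuous function together with its gradient. -/
def gradPair (b : Module.Basis (Fin 3) ℝ E3) {m : ℕ} (hm : 2 ≤ m) :
    PeriodicSobolev b 1 m →L[ℝ] GradPair b :=
  ((sobolevEmbedding b).comp (oneSubLaplacian b hm)).prod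
    (ContinuousLinearMap.pi fun j =>
      weakDerivL b m (Pi.single j 1) (single_one_mem_multiIndices hm j))

theorem gradPair_fst {m : ℕ} (hm : 2 ≤ m) (u : PeriodicSobolev b 1 m) :
    (gradPair b hm u).1 = sobolevEmbedding b (oneSubLaplacian b hm u) := rfl

theorem gradPair_snd {m : ℕ} (hm : 2 ≤ m) (u : PeriodicSobolev b 1 m) (j : Fin 3) :
    (gradPair b hm u).2 j = weakDeriv u (Pi.single j 1) (single_one_mem_multiIndices hm j) := rfl

theorem boundedToL2_gradPair {m : ℕ} (hm : 2 ≤ m) (u : PeriodicSobolev b 1 m) :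
    boundedToL2 b (gradPair b hm u).1 = toL2 u := by
  refine ext_fourierSeq b fun k => ?_
  rw [gradPair_fst, fourierSeq_sobolevEmbedding, fourierSeq_oneSubLaplacian,
    inv_mul_cancel_left₀ (resolventSymbol_ne_zero b k)]

theorem coeFn_gradPair {m : ℕ} (hm : 2 ≤ m) (u : PeriodicSobolev b 1 m) :
    (gradPair b hm u).1 =ᵐ[cellMeasure b 1] toL2 u := by
  rw [← boundedToL2_gradPair hm u]
  exact (coeFn_boundedToL2 b _).symm

theorem gradPair_eq_of_toL2_eq {m m' : ℕ} (hm : 2 ≤ m) (hm' : 2 ≤ m') {u : PeriodicSobolev b 1 m}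
    {v : PeriodicSobolev b 1 m'} (h : toL2 u = toL2 v) : gradPair b hm u = gradPair b hm' v := by
  refine Prod.ext ?_ (funext fun j => ?_)
  · rw [gradPair_fst, gradPair_fst]
    congr 1
    refine ext_fourierSeq b fun k => ?_
    rw [fourierSeq_oneSubLaplacian, fourierSeq_oneSubLaplacian, h]
  · refine (hasWeakDeriv u _ (single_one_mem_multiIndices hm j)).unique ?_
    rw [h]
    exact hasWeakDeriv v _ (single_one_mem_multiIndices hm' j)

/-- Fourier partial sums approximate elements of `H²` uniformly and in `H¹`. -/
theorem gradPair_mem_gradClosure {m : ℕ} (hm : 2 ≤ m) (u : PeriodicSobolev b 1 m) :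
    gradPair b hm u ∈ gradClosure b := by
  have h1 : HasSum (fun k => mode b k (fourierSeq b (toL2 u) k)) (gradPair b hm u).1 := by
    refine (hasSum_sobolevEmbedding b (oneSubLaplacian b hm u)).congr_fun fun k => ?_
    rw [fourierSeq_oneSubLaplacian, inv_mul_cancel_left₀ (resolventSymbol_ne_zero b k)]
  have h2 : ∀ j, HasSum (fun k => boundedToL2 b (mode b k (symbol b (Pi.single j 1) k *
      fourierSeq b (toL2 u) k))) ((gradPair b hm u).2 j) := by
    intro j
    have := hasSum_synth b (fourierSeq b ((gradPair b hm u).2 j))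
    rw [synth_fourierSeq] at this
    refine this.congr_fun fun k => ?_
    rw [gradPair_snd, fourierSeq_weakDeriv]
  have h3 := h1.prodMk (Pi.hasSum.2 h2)
  refine isClosed_gradClosure.mem_of_tendsto h3 (Filter.Eventually.of_forall fun s => ?_)
  exact Submodule.sum_mem _ fun k _ => (isSmoothPair_mode k _).mem_gradClosure

/-! ### The resolvent of the Laplacian -/

theorem symbol_add (α β : Fin 3 → ℕ) (k : Fin 3 → ℤ) :
    symbol b (α + β) k = symbol b α k * symbol b β k := by
  simp [symbol, pow_add, Finset.prod_mul_distrib]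

theorem norm_symbol_le (α : Fin 3 → ℕ) (k : Fin 3 → ℤ) :
    ‖symbol b α k‖ ≤ √(resolventSymbol b k) ^ (∑ j, α j) := by
  rw [symbol, norm_prod, ← Finset.prod_pow_eq_pow_sum]
  refine Finset.prod_le_prod (fun _ _ => norm_nonneg _) fun j _ => ?_
  rw [norm_pow, norm_mul, Complex.norm_I, one_mul, Complex.norm_real]
  exact pow_le_pow_left₀ (norm_nonneg _) (abs_freq_le b k j) _

theorem norm_symbol_mul_le {α : Fin 3 → ℕ} (hα : ∑ j, α j ≤ 4) (k : Fin 3 → ℤ) :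
    ‖symbol b α k * ((resolventSymbol b k : ℂ)⁻¹) ^ 2‖ ≤ 1 := by
  have hr := resolventSymbol_pos b k
  have h1 : 1 ≤ √(resolventSymbol b k) := Real.one_le_sqrt.2 (one_le_resolventSymbol b k)
  rw [norm_mul, norm_pow, norm_inv, Complex.norm_real, Real.norm_of_nonneg hr.le, inv_pow,
    mul_inv_le_iff₀ (by positivity), one_mul]
  calc ‖symbol b α k‖ ≤ √(resolventSymbol b k) ^ (∑ j, α j) := norm_symbol_le α k
    _ ≤ √(resolventSymbol b k) ^ 4 := pow_le_pow_right₀ h1 hα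
    _ = (√(resolventSymbol b k) ^ 2) ^ 2 := by ring
    _ = _ := by rw [Real.sq_sqrt hr.le]

/-- The operator `∂^α (1 - Δ)⁻²` on `L²`, for `|α| ≤ 4`. -/
def biresolvent (b : Module.Basis (Fin 3) ℝ E3) (α : Fin 3 → ℕ) (hα : ∑ j, α j ≤ 4) :
    PeriodicL2 b 1 →L[ℝ] PeriodicL2 b 1 :=
  multiplier b (fun k => symbol b α k * ((resolventSymbol b k : ℂ)⁻¹) ^ 2) 1 (norm_symbol_mul_le hα)

theorem fourierSeq_biresolvent (α : Fin 3 → ℕ) (hα : ∑ j, α j ≤ 4) (f : PeriodicL2 b 1)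
    (k : Fin 3 → ℤ) : fourierSeq b (biresolvent b α hα f) k =
      symbol b α k * ((resolventSymbol b k : ℂ)⁻¹) ^ 2 * fourierSeq b f k := by
  rw [biresolvent, fourierSeq_multiplier]
  intro k
  simp [symbol_neg, resolventSymbol_neg]

theorem sum_le_four_of_mem {α : Fin 3 → ℕ} (hα : α ∈ multiIndices 3) : ∑ j, α j ≤ 4 :=
  (mem_multiIndices.1 hα).trans (by norm_num)

theorem sum_add_single_le_four {α : Fin 3 → ℕ} (hα : α ∈ multiIndices 3) (j : Fin 3) :
    ∑ i, (α + (Pi.single j 1 : Fin 3 → ℕ)) i ≤ 4 := by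
  have := mem_multiIndices.1 hα
  simp [Finset.sum_add_distrib]
  omega

/-- The component `∂^α` of `resolvent`. -/
def resolventDeriv (b : Module.Basis (Fin 3) ℝ E3) (α : multiIndices 3) :
    GradPair b →L[ℝ] PeriodicL2 b 1 :=
  (biresolvent b α (sum_le_four_of_mem α.2)).comp
      ((boundedToL2 b).comp (ContinuousLinearMap.fst ℝ _ _)) -
    ∑ j, (biresolvent b (α.1 + Pi.single j 1) (sum_add_single_le_four α.2 j)).comp
      ((ContinuousLinearMap.proj j).comp (ContinuousLinearMap.snd ℝ _ _))

theorem fourierSeq_resolventDeriv (α : multiIndices 3) (d : GradPair b) (k : Fin 3 → ℤ) :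
    fourierSeq b (resolventDeriv b α d) k = symbol b α k * (((resolventSymbol b k : ℂ)⁻¹) ^ 2 *
      (fourierSeq b (boundedToL2 b d.1) k -
        ∑ j, symbol b (Pi.single j 1) k * fourierSeq b (d.2 j) k)) := by
  simp only [resolventDeriv, sub_apply, sum_apply,
    ContinuousLinearMap.comp_apply, ContinuousLinearMap.coe_fst', ContinuousLinearMap.coe_snd',
    ContinuousLinearMap.proj_apply, map_sub, map_sum, lp.coeFn_sub, Pi.sub_apply, lp.coeFn_sum,
    Finset.sum_apply, fourierSeq_biresolvent, symbol_add]
  rw [mul_sub, mul_sub, Finset.mul_sum, Finset.mul_sum]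
  congr 1
  · ring
  · exact Finset.sum_congr rfl fun j _ => by ring

/-- The operator `(w, g) ↦ (1 - Δ)⁻² (w - ∑ⱼ ∂ⱼ gⱼ)` with values in `H³`. When `g` is the weak
gradient of `w` this is `(1 - Δ)⁻¹ w`; in this form it is bounded on all pairs. -/
def resolvent (b : Module.Basis (Fin 3) ℝ E3) : GradPair b →L[ℝ] PeriodicSobolev b 1 3 :=
  ContinuousLinearMap.codRestrict
    ((PiLp.continuousLinearEquiv 1 ℝ fun _ : multiIndices 3 =>
      PeriodicL2 b 1).symm.toContinuousLinearMap.comp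
      (ContinuousLinearMap.pi fun α => resolventDeriv b α)) (PeriodicSobolev b 1 3) (by
    intro d α
    refine hasWeakDeriv_iff.2 fun k => ?_
    change fourierSeq b (resolventDeriv b α d) k =
      symbol b α k * fourierSeq b (resolventDeriv b ⟨0, zero_mem_multiIndices 3⟩ d) k
    rw [fourierSeq_resolventDeriv, fourierSeq_resolventDeriv, symbol_zero, one_mul])

theorem fourierSeq_toL2_resolvent {d : GradPair b} (hd : d ∈ gradClosure b) (k : Fin 3 → ℤ) :
    fourierSeq b (toL2 (resolvent b d)) k =
      (resolventSymbol b k : ℂ)⁻¹ * fourierSeq b (boundedToL2 b d.1) k := by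
  change fourierSeq b (resolventDeriv b ⟨0, zero_mem_multiIndices 3⟩ d) k = _
  rw [fourierSeq_resolventDeriv, symbol_zero, one_mul]
  have h1 : ∀ j, symbol b (Pi.single j 1) k * fourierSeq b (d.2 j) k =
      -((freq b k j : ℂ) ^ 2) * fourierSeq b (boundedToL2 b d.1) k := by
    intro j
    rw [(hasWeakDeriv_of_mem_gradClosure hd j).fourierSeq_eq, symbol_single]
    linear_combination (freq b k j : ℂ) ^ 2 * fourierSeq b (boundedToL2 b d.1) k * Complex.I_sq
  have h2 : fourierSeq b (boundedToL2 b d.1) k -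
      ∑ j, symbol b (Pi.single j 1) k * fourierSeq b (d.2 j) k =
      resolventSymbol b k * fourierSeq b (boundedToL2 b d.1) k := by
    simp only [h1, ← Finset.sum_mul, Finset.sum_neg_distrib, resolventSymbol]
    push_cast
    ring
  rw [h2]
  have := resolventSymbol_ne_zero b k
  field_simp

/-- `(1 - Δ) u = w` characterises `u = (1 - Δ)⁻¹ w`, already for `u ∈ H²`. -/
theorem toL2_eq_resolvent_iff {m : ℕ} (hm : 2 ≤ m) {d : GradPair b} (hd : d ∈ gradClosure b)
    (u : PeriodicSobolev b 1 m) :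
    toL2 u = toL2 (resolvent b d) ↔ oneSubLaplacian b hm u = boundedToL2 b d.1 := by
  constructor
  · intro h
    refine ext_fourierSeq b fun k => ?_
    rw [fourierSeq_oneSubLaplacian, h, fourierSeq_toL2_resolvent hd,
      mul_inv_cancel_left₀ (resolventSymbol_ne_zero b k)]
  · intro h
    refine ext_fourierSeq b fun k => ?_
    rw [fourierSeq_toL2_resolvent hd, ← h, fourierSeq_oneSubLaplacian,
      inv_mul_cancel_left₀ (resolventSymbol_ne_zero b k)]

end

/-! ### Composition operators -/

section

/-- Smooth real functions of one variable. -/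
abbrev SmoothFun : Type := {f : ℝ → ℝ // ContDiff ℝ ∞ f}

/-- The derivative of a smooth function. -/
def SmoothFun.deriv (f : SmoothFun) : SmoothFun :=
  ⟨_root_.deriv f.1, ((contDiff_infty_iff_deriv (f := f.1)).1 f.2).2⟩

theorem SmoothFun.hasDerivAt (f : SmoothFun) (t : ℝ) : HasDerivAt f.1 (f.deriv.1 t) t :=
  (((contDiff_infty_iff_deriv (f := f.1)).1 f.2).1 t).hasDerivAt

theorem exists_bound_comp (f : SmoothFun) (w : E3 →ᵇ ℝ) : ∃ C, ∀ x, ‖f.1 (w x)‖ ≤ C := by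
  obtain ⟨C, hC⟩ := (isCompact_closedBall (0 : ℝ) ‖w‖).exists_bound_of_continuousOn
    f.2.continuous.continuousOn
  exact ⟨C, fun x => hC _ (by simpa using w.norm_coe_le_norm x)⟩

/-- The composition operator `w ↦ f ∘ w` on bounded continuous functions. -/
def compBounded (f : SmoothFun) (w : E3 →ᵇ ℝ) : E3 →ᵇ ℝ :=
  BoundedContinuousFunction.ofNormedAddCommGroup (fun x => f.1 (w x))
    (f.2.continuous.comp w.continuous) (exists_bound_comp f w).choose
    (exists_bound_comp f w).choose_spec

theorem norm_sub_sub_mul_le {f : SmoothFun} {a t c : ℝ}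
    (h : ∀ s ∈ Metric.closedBall a |t|, |f.deriv.1 s - f.deriv.1 a| ≤ c) :
    |f.1 (a + t) - f.1 a - f.deriv.1 a * t| ≤ c * |t| := by
  have h1 := (convex_closedBall a |t|).norm_image_sub_le_of_norm_hasDerivWithin_le
    (f := fun s => f.1 s - f.deriv.1 a * s) (f' := fun s => f.deriv.1 s - f.deriv.1 a) (C := c)
    (x := a) (y := a + t)
    (fun s _ => by
      have h := (f.hasDerivAt s).sub ((hasDerivAt_id s).const_mul (f.deriv.1 a))
      rw [mul_one] at h
      exact h.hasDerivWithinAt)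
    (fun s hs => h s hs) (by simp) (by simp)
  have h2 : f.1 (a + t) - f.deriv.1 a * (a + t) - (f.1 a - f.deriv.1 a * a) =
      f.1 (a + t) - f.1 a - f.deriv.1 a * t := by ring
  rw [h2] at h1
  simpa using h1

/-- Multiplication of bounded continuous functions. -/
def mulBounded : (E3 →ᵇ ℝ) →L[ℝ] (E3 →ᵇ ℝ) →L[ℝ] (E3 →ᵇ ℝ) :=
  ContinuousLinearMap.mul ℝ (E3 →ᵇ ℝ)

theorem mulBounded_apply (u v : E3 →ᵇ ℝ) : mulBounded u v = u * v := rfl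

theorem hasFDerivAt_compBounded (f : SmoothFun) (w : E3 →ᵇ ℝ) :
    HasFDerivAt (compBounded f)
      (mulBounded (compBounded f.deriv w)) w := by
  rw [hasFDerivAt_iff_isLittleO_nhds_zero, Asymptotics.isLittleO_iff]
  intro c hc
  have hu := (isCompact_closedBall (0 : ℝ) (‖w‖ + 1)).uniformContinuousOn_of_continuous
    f.deriv.2.continuous.continuousOn
  obtain ⟨δ, hδ, hδc⟩ := Metric.uniformContinuousOn_iff_le.1 hu c hc
  filter_upwards [Metric.ball_mem_nhds (0 : E3 →ᵇ ℝ) (lt_min hδ one_pos)] with v hv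
  rw [mem_ball_zero_iff, lt_min_iff] at hv
  refine (BoundedContinuousFunction.norm_le (by positivity)).2 fun x => ?_
  have hw : |w x| ≤ ‖w‖ := w.norm_coe_le_norm x
  have hvx : |v x| ≤ ‖v‖ := v.norm_coe_le_norm x
  refine (norm_sub_sub_mul_le (f := f) (a := w x) (t := v x) (c := c) fun s hs => ?_).trans
    (by gcongr)
  rw [mem_closedBall_iff_norm, Real.norm_eq_abs] at hs
  refine hδc s ?_ (w x) ?_ ?_
  · rw [mem_closedBall_zero_iff, Real.norm_eq_abs]
    have := abs_add_le (s - w x) (w x)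
    rw [sub_add_cancel] at this
    linarith
  · rw [mem_closedBall_zero_iff, Real.norm_eq_abs]
    linarith
  · rw [Real.dist_eq]
    linarith

theorem contDiff_compBounded (f : SmoothFun) : ContDiff ℝ ∞ (compBounded f) := by
  rw [contDiff_infty]
  intro n
  induction n generalizing f with
  | zero =>
    refine contDiff_zero.2 (continuous_iff_continuousAt.2 fun w => ?_)
    exact (hasFDerivAt_compBounded f w).continuousAt
  | succ n ih =>
    have h : ContDiff ℝ n fun w => mulBounded (compBounded f.deriv w) :=
      ContDiff.comp (g := fun v => mulBounded v) (by fun_prop) (ih f.deriv)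
    exact contDiff_succ_iff_hasFDerivAt.2 ⟨_, h, hasFDerivAt_compBounded f⟩

/-! ### The algebra of continuous functions with square integrable gradient -/

variable (b : Module.Basis (Fin 3) ℝ E3)

/-- Multiplication of a square integrable function by a bounded continuous one. -/
def boundedMul : (E3 →ᵇ ℝ) →L[ℝ] PeriodicL2 b 1 →L[ℝ] PeriodicL2 b 1 :=
  ((ContinuousLinearMap.mul ℝ ℝ).holderL (cellMeasure b 1) ⊤ 2 2).comp
    (BoundedContinuousFunction.toLp ⊤ (cellMeasure b 1) ℝ)

theorem coeFn_boundedMul (w : E3 →ᵇ ℝ) (g : PeriodicL2 b 1) :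
    boundedMul b w g =ᵐ[cellMeasure b 1] fun x => w x * g x := by
  have h : boundedMul b w g = (ContinuousLinearMap.mul ℝ ℝ).holder 2
      (BoundedContinuousFunction.toLp ⊤ (cellMeasure b 1) ℝ w) g := rfl
  rw [h]
  filter_upwards [(ContinuousLinearMap.mul ℝ ℝ).coeFn_holder (r := 2)
    (BoundedContinuousFunction.toLp ⊤ (cellMeasure b 1) ℝ w) g,
    BoundedContinuousFunction.coeFn_toLp (p := ⊤) (cellMeasure b 1) ℝ w] with x h1 h2
  rw [h1, h2]
  rfl

theorem boundedMul_mul (u v : E3 →ᵇ ℝ) (g : PeriodicL2 b 1) :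
    boundedMul b (u * v) g = boundedMul b v (boundedMul b u g) := by
  refine Lp.ext ?_
  filter_upwards [coeFn_boundedMul b (u * v) g, coeFn_boundedMul b u g,
    coeFn_boundedMul b v (boundedMul b u g)] with x h1 h2 h3
  rw [h1, h3, h2, BoundedContinuousFunction.mul_apply]
  ring

variable {b}

/-- The product of functions, with gradient given by the product rule. -/
def pairMul : GradPair b →L[ℝ] GradPair b →L[ℝ] GradPair b :=
  LinearMap.mkContinuous₂
    (LinearMap.mk₂ ℝ (fun d e : GradPair b => ((d.1 * e.1, fun j =>
        boundedMul b d.1 (e.2 j) + boundedMul b e.1 (d.2 j)) : GradPair b))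
      (fun d d' e => by
        refine Prod.ext (add_mul _ _ _) (funext fun j => ?_)
        simp
        abel)
      (fun c d e => by
        refine Prod.ext (smul_mul_assoc _ _ _) (funext fun j => ?_)
        simp)
      (fun d e e' => by
        refine Prod.ext (mul_add _ _ _) (funext fun j => ?_)
        simp
        abel)
      (fun c d e => by
        refine Prod.ext (mul_smul_comm _ _ _) (funext fun j => ?_)
        simp))
    (1 + 2 * ‖boundedMul b‖) (fun d e => by
      have hd1 : ‖d.1‖ ≤ ‖d‖ := norm_fst_le d
      have he1 : ‖e.1‖ ≤ ‖e‖ := norm_fst_le e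
      have hd2 : ∀ j, ‖d.2 j‖ ≤ ‖d‖ := fun j => (norm_le_pi_norm d.2 j).trans (norm_snd_le d)
      have he2 : ∀ j, ‖e.2 j‖ ≤ ‖e‖ := fun j => (norm_le_pi_norm e.2 j).trans (norm_snd_le e)
      have h0 : 0 ≤ ‖boundedMul b‖ * (‖d‖ * ‖e‖) := by positivity
      refine norm_prod_le_iff.2 ⟨?_, (pi_norm_le_iff_of_nonneg (by positivity)).2 fun j => ?_⟩
      · calc ‖d.1 * e.1‖ ≤ ‖d.1‖ * ‖e.1‖ := norm_mul_le _ _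
          _ ≤ ‖d‖ * ‖e‖ := by gcongr
          _ ≤ (1 + 2 * ‖boundedMul b‖) * ‖d‖ * ‖e‖ := by linarith
      · calc ‖boundedMul b d.1 (e.2 j) + boundedMul b e.1 (d.2 j)‖
            ≤ ‖boundedMul b‖ * ‖d.1‖ * ‖e.2 j‖ + ‖boundedMul b‖ * ‖e.1‖ * ‖d.2 j‖ :=
              norm_add_le_of_le ((boundedMul b).le_opNorm₂ _ _) ((boundedMul b).le_opNorm₂ _ _)
          _ ≤ ‖boundedMul b‖ * ‖d‖ * ‖e‖ + ‖boundedMul b‖ * ‖e‖ * ‖d‖ := by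
              gcongr
              · exact he2 j
              · exact hd2 j
          _ ≤ (1 + 2 * ‖boundedMul b‖) * ‖d‖ * ‖e‖ := by
              have : 0 ≤ ‖d‖ * ‖e‖ := by positivity
              linarith)

theorem pairMul_fst (d e : GradPair b) : (pairMul d e).1 = d.1 * e.1 := rfl

theorem pairMul_snd (d e : GradPair b) (j : Fin 3) :
    (pairMul d e).2 j = boundedMul b d.1 (e.2 j) + boundedMul b e.1 (d.2 j) := rfl

theorem partialDeriv_mul (j : Fin 3) {f g : E3 → ℝ} (hf : ContDiff ℝ ∞ f) (hg : ContDiff ℝ ∞ g)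
    (x : E3) :
    partialDeriv j (f * g) x = f x * partialDeriv j g x + g x * partialDeriv j f x := by
  rw [partialDeriv, ((hf.differentiable (by simp) x).hasFDerivAt.mul
    (hg.differentiable (by simp) x).hasFDerivAt).fderiv]
  simp [partialDeriv]

theorem pairMul_mem_gradClosure {d e : GradPair b} (hd : d ∈ gradClosure b)
    (he : e ∈ gradClosure b) : pairMul d e ∈ gradClosure b := by
  refine map_mem_closure₂ (f := fun d e : GradPair b => pairMul d e)
    (pairMul (b := b)).continuous₂ hd he ?_
  intro d hd e he
  refine ⟨hd.1.mul he.1, fun R hR x => ?_, fun j => ?_⟩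
  · exact congrArg₂ (· * ·) (hd.2.1 R hR x) (he.2.1 R hR x)
  · filter_upwards [hd.2.2 j, he.2.2 j, coeFn_boundedMul b d.1 (e.2 j),
      coeFn_boundedMul b e.1 (d.2 j), Lp.coeFn_add (boundedMul b d.1 (e.2 j))
      (boundedMul b e.1 (d.2 j))] with x h1 h2 h3 h4 h5
    have h6 : partialDeriv j (pairMul d e).1 x = _ := partialDeriv_mul j hd.1 he.1 x
    rw [pairMul_snd, h5, Pi.add_apply, h3, h4, h6, h1, h2]

/-- Composition with a smooth function, with gradient given by the chain rule. -/
def pairComp (f : SmoothFun) (d : GradPair b) : GradPair b :=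
  (compBounded f d.1, fun j => boundedMul b (compBounded f.deriv d.1) (d.2 j))

theorem contDiff_pairComp (f : SmoothFun) : ContDiff ℝ ∞ (pairComp (b := b) f) := by
  refine ((contDiff_compBounded f).comp contDiff_fst).prodMk (contDiff_pi.2 fun j => ?_)
  exact ((boundedMul b).contDiff.comp ((contDiff_compBounded f.deriv).comp contDiff_fst)).clm_apply
    ((contDiff_apply ℝ (PeriodicL2 b 1) j).comp contDiff_snd)

theorem pairComp_fst (f : SmoothFun) (d : GradPair b) : (pairComp f d).1 = compBounded f d.1 := rfl

theorem pairComp_snd (f : SmoothFun) (d : GradPair b) (j : Fin 3) :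
    (pairComp f d).2 j = boundedMul b (compBounded f.deriv d.1) (d.2 j) := rfl

theorem hasFDerivAt_pairComp (f : SmoothFun) (d : GradPair b) :
    HasFDerivAt (pairComp f) (pairMul (pairComp f.deriv d)) d := by
  have h1 : HasFDerivAt (fun d : GradPair b => compBounded f d.1)
      ((mulBounded (compBounded f.deriv d.1)).comp (ContinuousLinearMap.fst ℝ _ _)) d :=
    (hasFDerivAt_compBounded f d.1).comp d hasFDerivAt_fst
  have h1' : HasFDerivAt (fun d : GradPair b => compBounded f.deriv d.1)
      ((mulBounded (compBounded f.deriv.deriv d.1)).comp (ContinuousLinearMap.fst ℝ _ _)) d :=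
    (hasFDerivAt_compBounded f.deriv d.1).comp d hasFDerivAt_fst
  have h1'' : HasFDerivAt (fun d : GradPair b => boundedMul b (compBounded f.deriv d.1))
      ((boundedMul b).comp ((mulBounded (compBounded f.deriv.deriv d.1)).comp
        (ContinuousLinearMap.fst ℝ _ _))) d :=
    (boundedMul b).hasFDerivAt.comp d h1'
  let q (j : Fin 3) : GradPair b →L[ℝ] PeriodicL2 b 1 :=
    (ContinuousLinearMap.proj (R := ℝ) (φ := fun _ : Fin 3 => PeriodicL2 b 1) j).comp
      (ContinuousLinearMap.snd ℝ (E3 →ᵇ ℝ) _)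
  have h3 : ∀ j, HasFDerivAt (fun d : GradPair b => d.2 j) (q j) d := fun j => (q j).hasFDerivAt
  have h2 := fun j => h1''.clm_apply (h3 j)
  refine (h1.prodMk (hasFDerivAt_pi.2 h2)).congr_fderiv ?_
  refine ContinuousLinearMap.ext fun e => Prod.ext ?_ (funext fun j => ?_)
  · rw [pairMul_fst, ContinuousLinearMap.prod_apply, ContinuousLinearMap.comp_apply,
      ContinuousLinearMap.coe_fst', mulBounded_apply, pairComp_fst]
  · rw [pairMul_snd, ContinuousLinearMap.prod_apply]
    dsimp only
    rw [ContinuousLinearMap.pi_apply, add_apply,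
      ContinuousLinearMap.comp_apply, ContinuousLinearMap.comp_apply, ContinuousLinearMap.coe_snd',
      ContinuousLinearMap.proj_apply, ContinuousLinearMap.flip_apply,
      ContinuousLinearMap.comp_apply, ContinuousLinearMap.comp_apply, ContinuousLinearMap.coe_fst',
      mulBounded_apply, boundedMul_mul, pairComp_fst, pairComp_snd]

theorem partialDeriv_comp (j : Fin 3) (f : SmoothFun) {w : E3 → ℝ} (hw : ContDiff ℝ ∞ w) (x : E3) :
    partialDeriv j (fun x => f.1 (w x)) x = f.deriv.1 (w x) * partialDeriv j w x := by
  have h : HasFDerivAt (fun x => f.1 (w x)) (f.deriv.1 (w x) • fderiv ℝ w x) x :=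
    (f.hasDerivAt (w x)).comp_hasFDerivAt x (hw.differentiable (by simp) x).hasFDerivAt
  rw [partialDeriv, h.fderiv]
  rfl

theorem pairComp_mem_gradClosure (f : SmoothFun) {d : GradPair b} (hd : d ∈ gradClosure b) :
    pairComp f d ∈ gradClosure b := by
  refine map_mem_closure (contDiff_pairComp f).continuous hd ?_
  intro d hd
  refine ⟨f.2.comp hd.1, fun R hR x => congrArg f.1 (hd.2.1 R hR x), fun j => ?_⟩
  filter_upwards [hd.2.2 j, coeFn_boundedMul b (compBounded f.deriv d.1) (d.2 j)] with x h1 h2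
  have h3 : partialDeriv j (pairComp f d).1 x = _ := partialDeriv_comp j f hd.1 x
  rw [h3, ← h1]
  exact h2

end

/-! ### Smooth implicit functions on a neighbourhood -/

section

/-- Smoothness of the implicit function on a whole interval: the implicit function theorem gives
regularity at the base point only, which for `C^∞` does not spread to a neighbourhood. It is applied
at all nearby points, and the local solutions agree by uniqueness. -/
theorem exists_contDiffOn_implicitFunction {E : Type*} [NormedAddCommGroup E] [NormedSpace ℝ E]
    [CompleteSpace E] {Φ : ℝ × E → E} (hΦ : ContDiff ℝ ∞ Φ) {u₀ : E} (h0 : Φ (0, u₀) = 0)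
    (hinv : (fderiv ℝ Φ (0, u₀) ∘L .inr ℝ ℝ E).IsInvertible) {r₀ : ℝ} (hr₀ : 0 < r₀) :
    ∃ ε : ℝ, 0 < ε ∧ ∃ r : ℝ, 0 < r ∧ r ≤ r₀ ∧ ∃ ψ : ℝ → E,
      ContDiffOn ℝ ∞ ψ (Set.Icc (-ε) ε) ∧ (∀ h ∈ Set.Icc (-ε) ε, ‖ψ h - u₀‖ ≤ r) ∧
      ∀ h ∈ Set.Icc (-ε) ε, ∀ u, ‖u - u₀‖ ≤ r → (Φ (h, u) = 0 ↔ ψ h = u) := by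
  have hne : (∞ : WithTop ℕ∞) ≠ 0 := by simp
  have hA : ContDiffAt ℝ ∞ Φ (0, u₀) := hΦ.contDiffAt
  set ψ := hA.implicitFunction hne hinv with hψ
  have e1 : ContDiffAt ℝ ∞ ψ 0 := hA.contDiffAt_implicitFunction hne hinv
  have e2 : ψ 0 = u₀ := hA.implicitFunction_apply_self hne hinv
  have e3 : ∀ᶠ v in 𝓝 ((0 : ℝ), u₀), Φ v = 0 ↔ ψ v.1 = v.2 := by
    have := hA.eventually_apply_eq_iff_implicitFunction hne hinv
    rwa [h0] at this
  obtain ⟨s, hs, t, ht, hst⟩ := Filter.mem_prod_iff.1 (nhds_prod_eq (x := (0 : ℝ)) (y := u₀) ▸ e3)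
  obtain ⟨r₁, hr₁, hrt⟩ := Metric.nhds_basis_closedBall.mem_iff.1 ht
  set r := min r₁ r₀ with hr
  have hrpos : 0 < r := lt_min hr₁ hr₀
  have hcont : ∀ᶠ h in 𝓝 (0 : ℝ), ContinuousAt ψ h := by
    have := (e1.of_le (m := 1) (by exact_mod_cast le_top)).eventually (by simp)
    exact this.mono fun h hh => hh.continuousAt
  have hψ0 : Filter.Tendsto ψ (𝓝 0) (𝓝 u₀) := by
    have := e1.continuousAt.tendsto
    rwa [e2] at this
  have hnear : ∀ᶠ h in 𝓝 (0 : ℝ), ‖ψ h - u₀‖ < r := by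
    filter_upwards [hψ0 (Metric.ball_mem_nhds u₀ hrpos)] with h hh
    simpa [dist_eq_norm] using hh
  have hinv' : ∀ᶠ h in 𝓝 (0 : ℝ), (fderiv ℝ Φ (h, ψ h) ∘L .inr ℝ ℝ E).IsInvertible := by
    have hc : Continuous fun v : ℝ × E => fderiv ℝ Φ v ∘L .inr ℝ ℝ E :=
      (hΦ.continuous_fderiv hne).clm_comp continuous_const
    have hopen : IsOpen {A : E →L[ℝ] E | A.IsInvertible} := ContinuousLinearEquiv.isOpen
    have ht : Filter.Tendsto (fun h : ℝ => (h, ψ h)) (𝓝 0) (𝓝 (0, u₀)) :=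
      Filter.tendsto_id.prodMk_nhds hψ0
    exact ht ((hopen.preimage hc).mem_nhds hinv)
  have hall : ∀ᶠ h in 𝓝 (0 : ℝ), h ∈ s ∧ ContinuousAt ψ h ∧ ‖ψ h - u₀‖ < r ∧
      (fderiv ℝ Φ (h, ψ h) ∘L .inr ℝ ℝ E).IsInvertible := by
    filter_upwards [hs, hcont, hnear, hinv'] with h h1 h2 h3 h4 using ⟨h1, h2, h3, h4⟩
  obtain ⟨ε', hε', hball⟩ := Metric.eventually_nhds_iff.1 hall
  have hin : ∀ h ∈ Set.Icc (-(ε' / 2)) (ε' / 2), dist h 0 < ε' := by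
    intro h hh
    rw [Real.dist_eq, sub_zero]
    exact (abs_le.2 hh).trans_lt (by linarith)
  have huniq : ∀ h, dist h 0 < ε' → ∀ u, ‖u - u₀‖ ≤ r → (Φ (h, u) = 0 ↔ ψ h = u) := by
    intro h hh u hu
    have hut : u ∈ t := hrt (by
      rw [Metric.mem_closedBall, dist_eq_norm]
      exact hu.trans (min_le_left _ _))
    exact hst (Set.mk_mem_prod (hball hh).1 hut)
  have hzero : ∀ h, dist h 0 < ε' → Φ (h, ψ h) = 0 := fun h hh =>
    (huniq h hh _ (hball hh).2.2.1.le).2 rfl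
  refine ⟨ε' / 2, by positivity, r, hrpos, min_le_right _ _, ψ, ?_, ?_, ?_⟩
  · intro h hh
    have hd := hin h hh
    have hB : ContDiffAt ℝ ∞ Φ (h, ψ h) := hΦ.contDiffAt
    have hi := (hball hd).2.2.2
    have k1 := hB.contDiffAt_implicitFunction hne hi
    have k2 := hB.eventually_apply_eq_iff_implicitFunction hne hi
    have k3 : Filter.Tendsto (fun h' : ℝ => (h', ψ h')) (𝓝 h) (𝓝 (h, ψ h)) :=
      Filter.tendsto_id.prodMk_nhds (hball hd).2.1
    have k4 : ∀ᶠ h' in 𝓝 h, dist h' 0 < ε' :=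
      (isOpen_lt (continuous_id.dist continuous_const) continuous_const).mem_nhds hd
    refine (k1.congr_of_eventuallyEq ?_).contDiffWithinAt
    filter_upwards [k3.eventually k2, k4] with h' h1 h2
    rw [hzero h hd] at h1
    exact (h1.1 (hzero h' h2)).symm
  · exact fun h hh => (hball (hin h hh)).2.2.1.le
  · exact fun h hh => huniq h (hin h hh)

/-! ### The nonlinearity -/

/-- The function `5/3 t^{7/3} - 4/3 t^{5/3}`, smoothly continued from `[c, ∞)` to the line. -/
theorem exists_smoothFun_eq {c : ℝ} (hc : 0 < c) :
    ∃ f : SmoothFun, ∀ t, c ≤ t → f.1 t = 5 / 3 * t ^ (7 / 3 : ℝ) - 4 / 3 * t ^ (5 / 3 : ℝ) := by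
  -- `χ` is positive and smooth, with `χ t = t` for `t ≥ c`
  let σ : ℝ → ℝ := fun t => Real.smoothTransition ((t - c / 2) / (c / 2))
  have hσ : ContDiff ℝ ∞ σ :=
    Real.smoothTransition.contDiff.comp ((contDiff_id.sub contDiff_const).div_const _)
  let χ : ℝ → ℝ := fun t => σ t * t + (1 - σ t)
  have hχ : ContDiff ℝ ∞ χ := (hσ.mul contDiff_id).add (contDiff_const.sub hσ)
  have hpos : ∀ t, 0 < χ t := by
    intro t
    have h0 : 0 ≤ σ t := Real.smoothTransition.nonneg _
    have h1 : σ t ≤ 1 := Real.smoothTransition.le_one _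
    rcases le_or_gt t (c / 2) with ht | ht
    · have : σ t = 0 := Real.smoothTransition.zero_of_nonpos
        (div_nonpos_of_nonpos_of_nonneg (by linarith) (by linarith))
      simp [χ, this]
    · have ht0 : 0 < t := by linarith
      rcases h0.eq_or_lt with h | h
      · simp [χ, ← h]
      · have := mul_pos h ht0
        change 0 < σ t * t + (1 - σ t)
        linarith
  have heq : ∀ t, c ≤ t → χ t = t := by
    intro t ht
    have : σ t = 1 := Real.smoothTransition.one_of_one_le (by
      rw [one_le_div (by linarith)]
      linarith)
    simp [χ, this]
  refine ⟨⟨fun t => 5 / 3 * χ t ^ (7 / 3 : ℝ) - 4 / 3 * χ t ^ (5 / 3 : ℝ), ?_⟩, fun t ht => ?_⟩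
  · exact (contDiff_const.mul (hχ.rpow_const_of_ne fun t => (hpos t).ne')).sub
      (contDiff_const.mul (hχ.rpow_const_of_ne fun t => (hpos t).ne'))
  · simp only [heq t ht]

theorem deriv_eq_of_eq {c : ℝ} (hc : 0 < c) {f : SmoothFun}
    (hf : ∀ t, c ≤ t → f.1 t = 5 / 3 * t ^ (7 / 3 : ℝ) - 4 / 3 * t ^ (5 / 3 : ℝ)) {t : ℝ}
    (ht : c < t) :
    f.deriv.1 t = 35 / 9 * t ^ (4 / 3 : ℝ) - 20 / 9 * t ^ (2 / 3 : ℝ) := by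
  have ht0 : t ≠ 0 := (hc.trans ht).ne'
  have h1 := ((Real.hasDerivAt_rpow_const (p := 7 / 3) (Or.inl ht0)).const_mul (5 / 3)).sub
    ((Real.hasDerivAt_rpow_const (p := 5 / 3) (Or.inl ht0)).const_mul (4 / 3))
  have h2 : f.1 =ᶠ[𝓝 t] fun t => 5 / 3 * t ^ (7 / 3 : ℝ) - 4 / 3 * t ^ (5 / 3 : ℝ) := by
    filter_upwards [lt_mem_nhds ht] with s hs using hf s hs.le
  rw [(f.hasDerivAt t).unique (h1.congr_of_eventuallyEq h2)]
  norm_num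
  ring

variable {b : Module.Basis (Fin 3) ℝ E3}

theorem exists_isSmoothPair {ρ : E3 → ℝ} (hρ : ContDiff ℝ ∞ ρ) (hper : IsPeriodic b 1 ρ) :
    ∃ d : GradPair b, IsSmoothPair d ∧ ∀ x, d.1 x = ρ x := by
  obtain ⟨C, hC⟩ := hper.exists_bound hρ.continuous
  exact ⟨(BoundedContinuousFunction.ofNormedAddCommGroup ρ hρ.continuous C hC,
    fun j => (memLp_of_isPeriodic (hper.partialDeriv j)
      (contDiff_partialDeriv j hρ).continuous).toLp _),
    ⟨hρ, hper, fun j => MemLp.coeFn_toLp (memLp_of_isPeriodic (hper.partialDeriv j)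
      (contDiff_partialDeriv j hρ).continuous)⟩, fun x => rfl⟩

/-- The nonlinearity `N` for which the Euler–Lagrange equations read `(1 - Δ) u = N(h, u)`. -/
def reaction (f : SmoothFun) (ρ : GradPair b) (h : ℝ) (d : Fin 3 → GradPair b) :
    Fin 3 → GradPair b :=
  ![d 0 - pairComp f (d 0) - pairMul (d 2) (d 0) + h • d 0,
    d 1 - pairComp f (d 1) - pairMul (d 2) (d 1) - h • d 1,
    d 2 + (4 * Real.pi) • (pairMul (d 0) (d 0) + pairMul (d 1) (d 1) - ρ)]

/-- The derivative of `reaction` at `h = 0` in the direction `e`. -/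
def reactionDeriv (f : SmoothFun) (d e : Fin 3 → GradPair b) : Fin 3 → GradPair b :=
  ![e 0 - pairMul (pairComp f.deriv (d 0)) (e 0) - (pairMul (d 2) (e 0) + pairMul (e 2) (d 0)),
    e 1 - pairMul (pairComp f.deriv (d 1)) (e 1) - (pairMul (d 2) (e 1) + pairMul (e 2) (d 1)),
    e 2 + (4 * Real.pi) • ((pairMul (d 0) (e 0) + pairMul (e 0) (d 0)) +
      (pairMul (d 1) (e 1) + pairMul (e 1) (d 1)))]

theorem contDiff_pairMul {X : Type*} [NormedAddCommGroup X] [NormedSpace ℝ X]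
    {p q : X → GradPair b} (hp : ContDiff ℝ ∞ p) (hq : ContDiff ℝ ∞ q) :
    ContDiff ℝ ∞ fun x => pairMul (p x) (q x) :=
  (pairMul (b := b)).isBoundedBilinearMap.contDiff.comp (hp.prodMk hq)

theorem hasDerivAt_pairMul {p q : ℝ → GradPair b} {p' q' : GradPair b} {t : ℝ}
    (hp : HasDerivAt p p' t) (hq : HasDerivAt q q' t) :
    HasDerivAt (fun t => pairMul (p t) (q t)) (pairMul (p t) q' + pairMul p' (q t)) t :=
  (pairMul (b := b)).hasDerivAt_of_bilinear (fun _ => hp) (fun _ => hq)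

theorem contDiff_reaction (f : SmoothFun) (ρ : GradPair b) :
    ContDiff ℝ ∞ fun p : ℝ × (Fin 3 → GradPair b) => reaction f ρ p.1 p.2 := by
  have hd : ∀ i, ContDiff ℝ ∞ fun p : ℝ × (Fin 3 → GradPair b) => p.2 i := fun i =>
    (contDiff_apply ℝ (GradPair b) i).comp contDiff_snd
  have hf : ∀ i, ContDiff ℝ ∞ fun p : ℝ × (Fin 3 → GradPair b) => pairComp f (p.2 i) := fun i =>
    (contDiff_pairComp f).comp (hd i)
  refine contDiff_pi.2 fun i => ?_
  fin_cases i
  · exact (((hd 0).sub (hf 0)).sub (contDiff_pairMul (hd 2) (hd 0))).add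
      (contDiff_fst.smul (hd 0))
  · exact (((hd 1).sub (hf 1)).sub (contDiff_pairMul (hd 2) (hd 1))).sub
      (contDiff_fst.smul (hd 1))
  · exact (hd 2).add (((contDiff_pairMul (hd 0) (hd 0)).add
      (contDiff_pairMul (hd 1) (hd 1))).sub contDiff_const |>.const_smul _)

theorem hasDerivAt_reaction (f : SmoothFun) (ρ : GradPair b) {γ : ℝ → Fin 3 → GradPair b}
    {e : Fin 3 → GradPair b} {t : ℝ} (hγ : HasDerivAt γ e t) :
    HasDerivAt (fun t => reaction f ρ 0 (γ t)) (reactionDeriv f (γ t) e) t := by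
  have hd : ∀ i, HasDerivAt (fun t => γ t i) (e i) t := hasDerivAt_pi.1 hγ
  have hf : ∀ i, HasDerivAt (fun t => pairComp f (γ t i))
      (pairMul (pairComp f.deriv (γ t i)) (e i)) t := fun i =>
    HasFDerivAt.comp_hasDerivAt (f := fun t => γ t i) (l := pairComp f) t
      (hasFDerivAt_pairComp f (γ t i)) (hd i)
  refine hasDerivAt_pi.2 fun i => ?_
  fin_cases i
  · have h := (((hd 0).sub (hf 0)).sub (hasDerivAt_pairMul (hd 2) (hd 0)))
    refine h.congr_of_eventuallyEq (Filter.Eventually.of_forall fun t => ?_)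
    simp [reaction]
  · have h := (((hd 1).sub (hf 1)).sub (hasDerivAt_pairMul (hd 2) (hd 1)))
    refine h.congr_of_eventuallyEq (Filter.Eventually.of_forall fun t => ?_)
    simp [reaction]
  · exact (hd 2).add (((hasDerivAt_pairMul (hd 0) (hd 0)).add
      (hasDerivAt_pairMul (hd 1) (hd 1))).sub_const ρ |>.const_smul (4 * Real.pi))

theorem reaction_mem_gradClosure (f : SmoothFun) {ρ : GradPair b} (hρ : ρ ∈ gradClosure b) (h : ℝ)
    {d : Fin 3 → GradPair b} (hd : ∀ i, d i ∈ gradClosure b) (i : Fin 3) :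
    reaction f ρ h d i ∈ gradClosure b := by
  have hf := fun i => pairComp_mem_gradClosure f (hd i)
  have hm := fun i j => pairMul_mem_gradClosure (hd i) (hd j)
  have hs := fun i => Submodule.smul_mem _ h (hd i)
  fin_cases i
  · exact add_mem (sub_mem (sub_mem (hd 0) (hf 0)) (hm 2 0)) (hs 0)
  · exact sub_mem (sub_mem (sub_mem (hd 1) (hf 1)) (hm 2 1)) (hs 1)
  · exact add_mem (hd 2) (Submodule.smul_mem _ _ (sub_mem (add_mem (hm 0 0) (hm 1 1)) hρ))

theorem reactionDeriv_mem_gradClosure (f : SmoothFun) {d e : Fin 3 → GradPair b}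
    (hd : ∀ i, d i ∈ gradClosure b) (he : ∀ i, e i ∈ gradClosure b) (i : Fin 3) :
    reactionDeriv f d e i ∈ gradClosure b := by
  have hf := fun i => pairMul_mem_gradClosure (pairComp_mem_gradClosure f.deriv (hd i)) (he i)
  have hm := fun i j => pairMul_mem_gradClosure (hd i) (he j)
  have hm' := fun i j => pairMul_mem_gradClosure (he i) (hd j)
  fin_cases i
  · exact sub_mem (sub_mem (he 0) (hf 0)) (add_mem (hm 2 0) (hm' 2 0))
  · exact sub_mem (sub_mem (he 1) (hf 1)) (add_mem (hm 2 1) (hm' 2 1))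
  · exact add_mem (he 2) (Submodule.smul_mem _ _
      (add_mem (add_mem (hm 0 0) (hm' 0 0)) (add_mem (hm 1 1) (hm' 1 1))))

end

/-! ### The fixed point equation -/

section

open PeriodicSobolev

variable {b : Module.Basis (Fin 3) ℝ E3}

-- the normed space structures of `Hᵐ` and `(Hᵐ)³`, recorded explicitly for instance search

instance (m : ℕ) : NormedSpace ℝ (PeriodicSobolev b 1 m) := Submodule.normedSpace _

instance (m : ℕ) : NormedAddCommGroup (Triple (PeriodicSobolev b 1 m)) :=
  PiLp.normedAddCommGroup 2 fun _ : Fin 3 => PeriodicSobolev b 1 m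

instance (m : ℕ) : NormedSpace ℝ (Triple (PeriodicSobolev b 1 m)) :=
  PiLp.normedSpace 2 ℝ fun _ : Fin 3 => PeriodicSobolev b 1 m

instance (m : ℕ) : CompleteSpace (Triple (PeriodicSobolev b 1 m)) :=
  PiLp.completeSpace 2 fun _ : Fin 3 => PeriodicSobolev b 1 m

/-- Componentwise application of `gradPair`. -/
def tripleGradPair (b : Module.Basis (Fin 3) ℝ E3) {m : ℕ} (hm : 2 ≤ m) :
    Triple (PeriodicSobolev b 1 m) →L[ℝ] (Fin 3 → GradPair b) :=
  ContinuousLinearMap.pi fun i => (gradPair b hm).comp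
    (PiLp.proj 2 (fun _ : Fin 3 => PeriodicSobolev b 1 m) i)

theorem tripleGradPair_mem {m : ℕ} (hm : 2 ≤ m) (u : Triple (PeriodicSobolev b 1 m)) (i : Fin 3) :
    tripleGradPair b hm u i ∈ gradClosure b := gradPair_mem_gradClosure hm (u i)

/-- Componentwise application of `resolvent`. -/
def tripleResolvent (b : Module.Basis (Fin 3) ℝ E3) :
    (Fin 3 → GradPair b) →L[ℝ] Triple (PeriodicSobolev b 1 3) :=
  (PiLp.continuousLinearEquiv 2 ℝ fun _ : Fin 3 =>
    PeriodicSobolev b 1 3).symm.toContinuousLinearMap.comp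
    (ContinuousLinearMap.pi fun i => (resolvent b).comp (ContinuousLinearMap.proj i))

theorem tripleResolvent_apply (d : Fin 3 → GradPair b) (i : Fin 3) :
    tripleResolvent b d i = resolvent b (d i) := rfl

theorem two_le_three : 2 ≤ 3 := by norm_num

/-- The map `(h, u) ↦ u - (1 - Δ)⁻¹ N(h, u)` on `(H³)³`, whose zeros are the solutions of the
Euler–Lagrange equations. -/
def residual (f : SmoothFun) (ρ : GradPair b) (p : ℝ × Triple (PeriodicSobolev b 1 3)) :
    Triple (PeriodicSobolev b 1 3) :=
  p.2 - tripleResolvent b (reaction f ρ p.1 (tripleGradPair b two_le_three p.2))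

theorem contDiff_sub_clm_comp {X Y : Type*} [NormedAddCommGroup X] [NormedSpace ℝ X]
    [NormedAddCommGroup Y] [NormedSpace ℝ Y] {N : ℝ → Y → Y}
    (hN : ContDiff ℝ ∞ fun p : ℝ × Y => N p.1 p.2) (A : X →L[ℝ] Y) (B : Y →L[ℝ] X) :
    ContDiff ℝ ∞ fun p : ℝ × X => p.2 - B (N p.1 (A p.2)) :=
  contDiff_snd.sub (B.contDiff.comp
    (hN.comp (contDiff_fst.prodMk (A.contDiff.comp contDiff_snd))))

theorem contDiff_residual (f : SmoothFun) (ρ : GradPair b) : ContDiff ℝ ∞ (residual f ρ) :=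
  contDiff_sub_clm_comp (contDiff_reaction f ρ) (tripleGradPair b two_le_three) (tripleResolvent b)

theorem fderiv_residual (f : SmoothFun) (ρ : GradPair b) (u w : Triple (PeriodicSobolev b 1 3)) :
    (fderiv ℝ (residual f ρ) (0, u) ∘L .inr ℝ ℝ _) w =
      w - tripleResolvent b (reactionDeriv f (tripleGradPair b two_le_three u)
        (tripleGradPair b two_le_three w)) := by
  have hl : HasDerivAt (fun t : ℝ => u + t • w) w 0 := by
    simpa using ((hasDerivAt_id (0 : ℝ)).smul_const w).const_add u
  have h1 : HasDerivAt (fun t : ℝ => residual f ρ (0, u + t • w))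
      (fderiv ℝ (residual f ρ) (0, u) (0, w)) 0 := by
    have hd : HasFDerivAt (residual f ρ) (fderiv ℝ (residual f ρ) (0, u))
        ((0 : ℝ), u + (0 : ℝ) • w) := by
      rw [zero_smul, add_zero]
      exact ((contDiff_residual f ρ).differentiable (by simp) _).hasFDerivAt
    exact HasFDerivAt.comp_hasDerivAt (f := fun t : ℝ => ((0 : ℝ), u + t • w)) 0 hd
      ((hasDerivAt_const _ _).prodMk hl)
  have hK : HasDerivAt (fun t : ℝ => tripleGradPair b two_le_three (u + t • w))
      (tripleGradPair b two_le_three w) 0 :=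
    (tripleGradPair b two_le_three).hasFDerivAt.comp_hasDerivAt 0 hl
  have h2 : HasDerivAt (fun t : ℝ => residual f ρ (0, u + t • w))
      (w - tripleResolvent b (reactionDeriv f (tripleGradPair b two_le_three (u + (0 : ℝ) • w))
        (tripleGradPair b two_le_three w))) 0 :=
    hl.sub ((tripleResolvent b).hasFDerivAt.comp_hasDerivAt 0 (hasDerivAt_reaction f ρ hK))
  rw [zero_smul, add_zero] at h2
  exact h1.unique h2

theorem eq_tripleResolvent_iff {d : Fin 3 → GradPair b} (hd : ∀ i, d i ∈ gradClosure b)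
    (u : Triple (PeriodicSobolev b 1 3)) :
    u = tripleResolvent b d ↔
      ∀ i, oneSubLaplacian b two_le_three (u i) = boundedToL2 b (d i).1 := by
  constructor
  · intro h i
    refine (toL2_eq_resolvent_iff two_le_three (hd i) (u i)).1 ?_
    rw [h, tripleResolvent_apply]
  · intro h
    refine PiLp.ext fun i => ext_toL2 ?_
    exact (toL2_eq_resolvent_iff two_le_three (hd i) (u i)).2 (h i)

theorem residual_eq_zero_iff (f : SmoothFun) {ρ : GradPair b} (hρ : ρ ∈ gradClosure b) (h : ℝ)
    (u : Triple (PeriodicSobolev b 1 3)) :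
    residual f ρ (h, u) = 0 ↔ ∀ i, oneSubLaplacian b two_le_three (u i) =
      boundedToL2 b (reaction f ρ h (tripleGradPair b two_le_three u) i).1 := by
  rw [residual, sub_eq_zero]
  exact eq_tripleResolvent_iff
    (fun i => reaction_mem_gradClosure f hρ h (tripleGradPair_mem two_le_three u) i) u

theorem ae_eq_boundedToL2_iff (g : PeriodicL2 b 1) (w : E3 →ᵇ ℝ) :
    g = boundedToL2 b w ↔ ∀ᵐ x ∂(cellMeasure b 1), g x = w x := by
  constructor
  · rintro rfl
    exact coeFn_boundedToL2 b w
  · intro h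
    refine Lp.ext ?_
    filter_upwards [h, coeFn_boundedToL2 b w] with x h1 h2
    rw [h1, h2]

theorem solvesEulerLagrange_iff {ρb : E3 → ℝ} {ρ : GradPair b} (hρ : ρ ∈ gradClosure b)
    (hρb : ∀ x, ρ.1 x = ρb x) {c : ℝ} (hc : 0 < c) {f : SmoothFun}
    (hf : ∀ t, c ≤ t → f.1 t = 5 / 3 * t ^ (7 / 3 : ℝ) - 4 / 3 * t ^ (5 / 3 : ℝ)) (h : ℝ)
    {u : Triple (PeriodicSobolev b 1 3)}
    (hu : ∀ᵐ x ∂(cellMeasure b 1), c ≤ toL2 (u 0) x ∧ c ≤ toL2 (u 1) x) :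
    SolvesEulerLagrange b ρb h u ↔ residual f ρ (h, u) = 0 := by
  rw [residual_eq_zero_iff f hρ, Fin.forall_fin_succ, Fin.forall_fin_two]
  simp only [ae_eq_boundedToL2_iff, ← Filter.eventually_and]
  refine Filter.eventually_congr ?_
  filter_upwards [hu, coeFn_oneSubLaplacian two_le_three (u 0),
    coeFn_oneSubLaplacian two_le_three (u 1), coeFn_oneSubLaplacian two_le_three (u 2),
    coeFn_gradPair two_le_three (u 0), coeFn_gradPair two_le_three (u 1),
    coeFn_gradPair two_le_three (u 2)] with x hx l0 l1 l2 g0 g1 g2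
  have r0 : (reaction f ρ h (tripleGradPair b two_le_three u) 0).1 x =
      (gradPair b two_le_three (u 0)).1 x - f.1 ((gradPair b two_le_three (u 0)).1 x) -
        (gradPair b two_le_three (u 2)).1 x * (gradPair b two_le_three (u 0)).1 x +
        h * (gradPair b two_le_three (u 0)).1 x := rfl
  have r1 : (reaction f ρ h (tripleGradPair b two_le_three u) 1).1 x =
      (gradPair b two_le_three (u 1)).1 x - f.1 ((gradPair b two_le_three (u 1)).1 x) -
        (gradPair b two_le_three (u 2)).1 x * (gradPair b two_le_three (u 1)).1 x -
        h * (gradPair b two_le_three (u 1)).1 x := rfl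
  have r2 : (reaction f ρ h (tripleGradPair b two_le_three u) 2).1 x =
      (gradPair b two_le_three (u 2)).1 x + (4 * Real.pi) *
        ((gradPair b two_le_three (u 0)).1 x * (gradPair b two_le_three (u 0)).1 x +
        (gradPair b two_le_three (u 1)).1 x * (gradPair b two_le_three (u 1)).1 x - ρ.1 x) := rfl
  rw [g0, g2, hf _ hx.1] at r0
  rw [g1, g2, hf _ hx.2] at r1
  rw [g0, g1, g2, hρb] at r2
  have e0 : (0 : ℝ) ≤ toL2 (u 0) x := hc.le.trans hx.1
  have e1 : (0 : ℝ) ≤ toL2 (u 1) x := hc.le.trans hx.2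
  change _ ↔ (oneSubLaplacian b two_le_three (u 0) x =
      (reaction f ρ h (tripleGradPair b two_le_three u) 0).1 x ∧
    oneSubLaplacian b two_le_three (u 1) x =
      (reaction f ρ h (tripleGradPair b two_le_three u) 1).1 x ∧
    oneSubLaplacian b two_le_three (u 2) x =
      (reaction f ρ h (tripleGradPair b two_le_three u) 2).1 x)
  rw [l0, l1, l2, r0, r1, r2]
  constructor
  · rintro ⟨-, -, a0, a1, a2⟩
    exact ⟨by linear_combination a0, by linear_combination a1, by linear_combination a2⟩
  · rintro ⟨a0, a1, a2⟩
    exact ⟨e0, e1, by linear_combination a0, by linear_combination a1, by linear_combination a2⟩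

/-! ### Invertibility of the linearised equation -/

theorem ae_periodicExtension (g : E3 → ℝ) :
    ∀ᵐ x ∂(cellMeasure b 1), periodicExtension b g x = g x := by
  filter_upwards [ae_mem_fundamentalDomain b] with x hx
  rw [periodicExtension, ZSpan.fract_eq_self.2 hx]

/-- The linearised Euler–Lagrange operator `L` satisfies `L θ = r` if and only if
`(1 - Δ) θ = N'(u) θ + r'`, where `r'` is `r` with its last component rescaled. -/
theorem linearizedEq_iff {c : ℝ} (hc : 0 < c) {f : SmoothFun}
    (hf : ∀ t, c ≤ t → f.1 t = 5 / 3 * t ^ (7 / 3 : ℝ) - 4 / 3 * t ^ (5 / 3 : ℝ))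
    {u : Triple (PeriodicSobolev b 1 3)}
    (hu : ∀ᵐ x ∂(cellMeasure b 1), c < toL2 (u 0) x ∧ c < toL2 (u 1) x)
    (θ : Triple (PeriodicSobolev b 1 2)) (r s : Triple (PeriodicL2 b 1)) (hr0 : r 0 = s 0)
    (hr1 : r 1 = s 1) (hr2 : r 2 = (-(1 / (8 * Real.pi))) • s 2) :
    LinearizedEq b 1 (periodicExtension b (toL2 (u 0))) (periodicExtension b (toL2 (u 1)))
      (periodicExtension b (toL2 (u 2))) θ r ↔
    ∀ i, oneSubLaplacian b le_rfl (θ i) = boundedToL2 b (reactionDeriv f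
      (tripleGradPair b two_le_three u) (tripleGradPair b le_rfl θ) i).1 + s i := by
  simp only [← sub_eq_iff_eq_add]
  rw [Fin.forall_fin_succ, Fin.forall_fin_two]
  simp only [ae_eq_boundedToL2_iff, ← Filter.eventually_and]
  refine Filter.eventually_congr ?_
  filter_upwards [hu, coeFn_oneSubLaplacian le_rfl (θ 0),
    coeFn_oneSubLaplacian le_rfl (θ 1), coeFn_oneSubLaplacian le_rfl (θ 2),
    coeFn_gradPair two_le_three (u 0), coeFn_gradPair two_le_three (u 1),
    coeFn_gradPair two_le_three (u 2), coeFn_gradPair le_rfl (θ 0), coeFn_gradPair le_rfl (θ 1),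
    coeFn_gradPair le_rfl (θ 2), ae_periodicExtension (b := b) (toL2 (u 0)),
    ae_periodicExtension (b := b) (toL2 (u 1)), ae_periodicExtension (b := b) (toL2 (u 2)),
    Lp.coeFn_sub (oneSubLaplacian b le_rfl (θ 0)) (s 0),
    Lp.coeFn_sub (oneSubLaplacian b le_rfl (θ 1)) (s 1),
    Lp.coeFn_sub (oneSubLaplacian b le_rfl (θ 2)) (s 2),
    Lp.coeFn_smul (-(1 / (8 * Real.pi))) (s 2)]
    with x hx l0 l1 l2 g0 g1 g2 t0 t1 t2 p0 p1 p2 s0 s1 s2 s3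
  have r0 : (reactionDeriv f (tripleGradPair b two_le_three u) (tripleGradPair b le_rfl θ) 0).1 x =
      (gradPair b le_rfl (θ 0)).1 x -
        f.deriv.1 ((gradPair b two_le_three (u 0)).1 x) * (gradPair b le_rfl (θ 0)).1 x -
        ((gradPair b two_le_three (u 2)).1 x * (gradPair b le_rfl (θ 0)).1 x +
          (gradPair b le_rfl (θ 2)).1 x * (gradPair b two_le_three (u 0)).1 x) := rfl
  have r1 : (reactionDeriv f (tripleGradPair b two_le_three u) (tripleGradPair b le_rfl θ) 1).1 x =
      (gradPair b le_rfl (θ 1)).1 x -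
        f.deriv.1 ((gradPair b two_le_three (u 1)).1 x) * (gradPair b le_rfl (θ 1)).1 x -
        ((gradPair b two_le_three (u 2)).1 x * (gradPair b le_rfl (θ 1)).1 x +
          (gradPair b le_rfl (θ 2)).1 x * (gradPair b two_le_three (u 1)).1 x) := rfl
  have r2 : (reactionDeriv f (tripleGradPair b two_le_three u) (tripleGradPair b le_rfl θ) 2).1 x =
      (gradPair b le_rfl (θ 2)).1 x + (4 * Real.pi) *
        (((gradPair b two_le_three (u 0)).1 x * (gradPair b le_rfl (θ 0)).1 x +
          (gradPair b le_rfl (θ 0)).1 x * (gradPair b two_le_three (u 0)).1 x) +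
        ((gradPair b two_le_three (u 1)).1 x * (gradPair b le_rfl (θ 1)).1 x +
          (gradPair b le_rfl (θ 1)).1 x * (gradPair b two_le_three (u 1)).1 x)) := rfl
  rw [g0, g2, t0, t2, deriv_eq_of_eq hc hf hx.1] at r0
  rw [g1, g2, t1, t2, deriv_eq_of_eq hc hf hx.2] at r1
  rw [g0, g1, t0, t1, t2] at r2
  change _ ↔ ((oneSubLaplacian b le_rfl (θ 0) - s 0 : PeriodicL2 b 1) x =
      (reactionDeriv f (tripleGradPair b two_le_three u) (tripleGradPair b le_rfl θ) 0).1 x ∧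
    (oneSubLaplacian b le_rfl (θ 1) - s 1 : PeriodicL2 b 1) x =
      (reactionDeriv f (tripleGradPair b two_le_three u) (tripleGradPair b le_rfl θ) 1).1 x ∧
    (oneSubLaplacian b le_rfl (θ 2) - s 2 : PeriodicL2 b 1) x =
      (reactionDeriv f (tripleGradPair b two_le_three u) (tripleGradPair b le_rfl θ) 2).1 x)
  rw [s0, s1, s2, r0, r1, r2]
  simp only [Pi.sub_apply, l0, l1, l2, p0, p1, p2, hr0, hr1, hr2, s3, Pi.smul_apply, smul_eq_mul]
  have hpi : Real.pi ≠ 0 := Real.pi_ne_zero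
  refine and_congr ?_ (and_congr ?_ ?_)
  · constructor <;> intro a <;> linear_combination a
  · constructor <;> intro a <;> linear_combination a
  · constructor <;> intro a
    · field_simp at a
      linear_combination -a
    · field_simp
      linear_combination -a

theorem exists_restrict {m m' : ℕ} (hm : m ≤ m') (u : PeriodicSobolev b 1 m') :
    ∃ θ : PeriodicSobolev b 1 m, toL2 θ = toL2 u := by
  have hsub : ∀ α : multiIndices m, (α : Fin 3 → ℕ) ∈ multiIndices m' := fun α =>
    mem_multiIndices.2 ((mem_multiIndices.1 α.2).trans hm)
  exact ⟨⟨WithLp.toLp 1 fun α => weakDeriv u α (hsub α), fun α => hasWeakDeriv u α (hsub α)⟩, rfl⟩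

/-- Stability makes the derivative of `residual` at the periodic ground state invertible. -/
theorem isInvertible_fderiv_residual {c : ℝ} (hc : 0 < c) {f : SmoothFun}
    (hf : ∀ t, c ≤ t → f.1 t = 5 / 3 * t ^ (7 / 3 : ℝ) - 4 / 3 * t ^ (5 / 3 : ℝ)) (ρ : GradPair b)
    {u : Triple (PeriodicSobolev b 1 3)}
    (hu : ∀ᵐ x ∂(cellMeasure b 1), c < toL2 (u 0) x ∧ c < toL2 (u 1) x) (hst : IsStable b u) :
    (fderiv ℝ (residual f ρ) (0, u) ∘L .inr ℝ ℝ _).IsInvertible := by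
  obtain ⟨M, hM⟩ := hst
  obtain ⟨T, -, hT⟩ := hM 1 le_rfl
  set A := fderiv ℝ (residual f ρ) (0, u) ∘L .inr ℝ ℝ _ with hA
  have hAw : ∀ w, A w = w - tripleResolvent b (reactionDeriv f (tripleGradPair b two_le_three u)
      (tripleGradPair b two_le_three w)) := fderiv_residual f ρ u
  have hmem : ∀ {m : ℕ} (hm : 2 ≤ m) (w : Triple (PeriodicSobolev b 1 m)) (i : Fin 3),
      reactionDeriv f (tripleGradPair b two_le_three u) (tripleGradPair b hm w) i ∈
        gradClosure b := fun hm w i =>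
    reactionDeriv_mem_gradClosure f (tripleGradPair_mem two_le_three u) (tripleGradPair_mem hm w) i
  have hinj : A.ker = ⊥ := by
    refine LinearMap.ker_eq_bot'.2 fun w hw => ?_
    have h1 : w = tripleResolvent b (reactionDeriv f (tripleGradPair b two_le_three u)
        (tripleGradPair b two_le_three w)) := sub_eq_zero.1 ((hAw w).symm.trans hw)
    have h2 := (eq_tripleResolvent_iff (hmem two_le_three w) w).1 h1
    choose θ hθ using fun i => exists_restrict two_le_three (w i)
    have hK : tripleGradPair b le_rfl (WithLp.toLp 2 θ) = tripleGradPair b two_le_three w :=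
      funext fun i => gradPair_eq_of_toL2_eq le_rfl two_le_three (hθ i)
    have h3 := (linearizedEq_iff hc hf hu (WithLp.toLp 2 θ) 0 0 rfl rfl (by simp)).2 (fun i => by
      rw [hK, ← h2 i, PiLp.zero_apply, add_zero]
      refine ext_fourierSeq b fun k => ?_
      rw [fourierSeq_oneSubLaplacian, fourierSeq_oneSubLaplacian, ← hθ i])
    have h4 := (hT 0 (WithLp.toLp 2 fun i => toL2 (θ i))).2 ⟨WithLp.toLp 2 θ, fun i => rfl, h3⟩
    rw [map_zero] at h4
    refine PiLp.ext fun i => ext_toL2 ?_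
    rw [← hθ i]
    exact (congrArg (fun v : Triple (PeriodicL2 b 1) => v i) h4).symm
  have hsurj : A.range = ⊤ := by
    refine LinearMap.range_eq_top.2 fun g => ?_
    let s : Triple (PeriodicL2 b 1) :=
      WithLp.toLp 2 fun i => oneSubLaplacian b two_le_three (g i)
    let r : Triple (PeriodicL2 b 1) :=
      WithLp.toLp 2 ![s 0, s 1, (-(1 / (8 * Real.pi))) • s 2]
    obtain ⟨θ, -, hθ⟩ := (hT r (T r)).1 rfl
    have h1 := (linearizedEq_iff hc hf hu θ r s rfl rfl rfl).1 hθ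
    -- `θ ∈ H²` solves `θ - g = (1 - Δ)⁻¹ N'(u) θ`, and the right-hand side lies in `H³`
    let w := g + tripleResolvent b (reactionDeriv f (tripleGradPair b two_le_three u)
      (tripleGradPair b le_rfl θ))
    have hw : ∀ i, toL2 (w i) = toL2 (θ i) := by
      intro i
      refine ext_fourierSeq b fun k => ?_
      have h2 := congrArg (fun v => fourierSeq b v k) (h1 i)
      simp only [map_add, lp.coeFn_add, Pi.add_apply, fourierSeq_oneSubLaplacian, s] at h2
      have h3 : toL2 (w i) = toL2 (g i) + toL2 (resolvent b (reactionDeriv f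
          (tripleGradPair b two_le_three u) (tripleGradPair b le_rfl θ) i)) := rfl
      rw [h3, map_add, lp.coeFn_add, Pi.add_apply, fourierSeq_toL2_resolvent (hmem le_rfl θ i)]
      have h4 := resolventSymbol_ne_zero b k
      field_simp
      rw [h2]
      ring
    have hK : tripleGradPair b two_le_three w = tripleGradPair b le_rfl θ :=
      funext fun i => gradPair_eq_of_toL2_eq two_le_three le_rfl (hw i)
    refine ⟨w, (hAw w).trans ?_⟩
    rw [hK]
    exact add_sub_cancel_right _ _
  exact ⟨ContinuousLinearEquiv.ofBijective A hinj hsurj,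
    ContinuousLinearEquiv.coe_ofBijective A hinj hsurj⟩

/-- Densities bounded below by `2 * c` stay bounded below by `c` under small perturbations in
`(H³)³`, as `H³` embeds into the bounded functions. -/
theorem ae_le_of_norm_sub_le {c : ℝ} {u v : Triple (PeriodicSobolev b 1 3)}
    (hu : ∀ᵐ x ∂(cellMeasure b 1), 2 * c ≤ toL2 (u 0) x ∧ 2 * c ≤ toL2 (u 1) x)
    (huv : ‖tripleGradPair b two_le_three‖ * ‖v - u‖ ≤ c) :
    ∀ᵐ x ∂(cellMeasure b 1), c ≤ toL2 (v 0) x ∧ c ≤ toL2 (v 1) x := by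
  have h1 : ∀ i x, |(gradPair b two_le_three (v i)).1 x - (gradPair b two_le_three (u i)).1 x| ≤
      c := by
    intro i x
    calc |(gradPair b two_le_three (v i)).1 x - (gradPair b two_le_three (u i)).1 x|
        = ‖(tripleGradPair b two_le_three (v - u) i).1 x‖ := by
          rw [map_sub]
          rfl
      _ ≤ ‖(tripleGradPair b two_le_three (v - u) i).1‖ :=
          BoundedContinuousFunction.norm_coe_le_norm _ x
      _ ≤ ‖tripleGradPair b two_le_three (v - u) i‖ := norm_fst_le _
      _ ≤ ‖tripleGradPair b two_le_three (v - u)‖ := norm_le_pi_norm _ i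
      _ ≤ ‖tripleGradPair b two_le_three‖ * ‖v - u‖ := ContinuousLinearMap.le_opNorm _ _
      _ ≤ c := huv
  filter_upwards [hu, coeFn_gradPair two_le_three (u 0), coeFn_gradPair two_le_three (u 1),
    coeFn_gradPair two_le_three (v 0), coeFn_gradPair two_le_three (v 1)] with x hx g0 g1 g2 g3
  have a0 := abs_le.1 (h1 0 x)
  have a1 := abs_le.1 (h1 1 x)
  rw [g0, g2] at a0
  rw [g1, g3] at a1
  exact ⟨by linarith [hx.1, a0.1], by linarith [hx.2, a1.1]⟩

end

end TFDW

end

theorem mainTheorem2 (b : Module.Basis (Fin 3) ℝ TFDW.E3)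
    (ρb : TFDW.E3 → ℝ) (hρb_smooth : ContDiff ℝ ∞ ρb) (hρb_per : TFDW.IsPeriodic b 1 ρb)
    (uPer : TFDW.Triple (TFDW.PeriodicSobolev b 1 3))
    (huPer : TFDW.SolvesEulerLagrange b ρb 0 uPer)
    (Cν : ℝ) (hCν : 0 < Cν)
    (hpos : ∀ᵐ x ∂(TFDW.cellMeasure b 1),
      Cν ≤ TFDW.PeriodicSobolev.toL2 (uPer 0) x ∧ Cν ≤ TFDW.PeriodicSobolev.toL2 (uPer 1) x)
    (hstable : TFDW.IsStable b uPer) :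
    ∃ h₀ : ℝ, 0 < h₀ ∧ ∃ δ : ℝ, 0 < δ ∧
      ∃ u : ℝ → TFDW.Triple (TFDW.PeriodicSobolev b 1 3),
        TFDW.IsCauchyBornMap b ρb uPer h₀ δ u ∧
          ∀ v : ℝ → TFDW.Triple (TFDW.PeriodicSobolev b 1 3),
            TFDW.IsCauchyBornMap b ρb uPer h₀ δ v → Set.EqOn v u (Set.Icc (-h₀) h₀) := by
  have hc : 0 < Cν / 2 := by positivity
  obtain ⟨f, hf⟩ := TFDW.exists_smoothFun_eq hc
  obtain ⟨ρ, hρ, hρb⟩ := TFDW.exists_isSmoothPair hρb_smooth hρb_per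
  -- within distance `Cν / 2 / (K + 1)` of `uPer` the densities stay above `Cν / 2`
  set K := ‖TFDW.tripleGradPair b TFDW.two_le_three‖ with hK
  have hsolves : ∀ (h : ℝ) (u : TFDW.Triple (TFDW.PeriodicSobolev b 1 3)),
      ‖u - uPer‖ ≤ Cν / 2 / (K + 1) →
      (TFDW.SolvesEulerLagrange b ρb h u ↔ TFDW.residual f ρ (h, u) = 0) := by
    intro h u hu
    refine TFDW.solvesEulerLagrange_iff hρ.mem_gradClosure hρb hc hf h ?_
    refine TFDW.ae_le_of_norm_sub_le (u := uPer) ?_ ?_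
    · filter_upwards [hpos] with x hx
      rwa [mul_div_cancel₀ _ (two_ne_zero' ℝ)]
    · have hK0 : 0 ≤ K := ContinuousLinearMap.opNorm_nonneg _
      rw [le_div_iff₀ (by linarith)] at hu
      have := norm_nonneg (u - uPer)
      rw [← hK]
      linarith
  have hr₀ : 0 < Cν / 2 / (K + 1) := by positivity
  obtain ⟨ε, hε, r, hr, hrr, ψ, hψ, hψr, hψu⟩ :=
    TFDW.exists_contDiffOn_implicitFunction (TFDW.contDiff_residual f ρ) (u₀ := uPer)
      ((hsolves 0 uPer (by simpa using hr₀.le)).1 huPer)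
      (TFDW.isInvertible_fderiv_residual hc hf ρ (by
        filter_upwards [hpos] with x hx
        exact ⟨by linarith [hx.1], by linarith [hx.2]⟩) hstable) hr₀
  refine ⟨ε, hε, r, hr, ψ, ⟨hψ, fun h hh => ⟨hψr h hh, ?_⟩⟩, fun v hv h hh => ?_⟩
  · exact (hsolves h _ ((hψr h hh).trans hrr)).2 ((hψu h hh _ (hψr h hh)).2 rfl)
  · obtain ⟨h1, h2⟩ := hv.2 h hh
    exact ((hψu h hh _ h1).1 ((hsolves h _ (h1.trans hrr)).1 h2)).symm
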